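/- Let $p$ be a prime. A subgroup $F$ of a group $X$ is called $p$-separable if for every $g\in X\setminus F$ there is a homomorphism $\psi$ of $X$ onto a finite $p$-group with $\psi(g)\notin\psi(F)$; the group $X$ is residually $p$-finite if its trivial subgroup is $p$-separable. A subgroup $Y$ of $X$ is called $p'$-isolated if for every $g\in X$ and every prime $q\neq p$, $g^q\in Y$ implies $g\in Y$. Let $A$ and $B$ be finitely generated nilpotent groups that are residually $p$-finite. Let $h\in A$ and $k\in B$ be such that $\langle h\rangle$ is maximal (with respect to inclusion) among the infinite cyclic subgroups of $A$ and $\langle k\rangle$ is maximal among the infinite cyclic subgroups of $B$. Let $m=p^s$ and $n=p^t$ with integers $s,t\ge 0$, let $H=\langle h^m\rangle\le A$ and $K=\langle k^n\rangle\le B$, let $\varphi\colon H\to K$ be an isomorphism, and let $G=(A*B;\ H=K,\varphi)$ be the free product of $A$ and $B$ with $H$ and $K$ amalgamated according to $\varphi$, that is, the quotient of the free product $A*B$ by the normal closure of $\{a\,\varphi(a)^{-1} : a\in H\}$. Then every $p'$-isolated cyclic subgroup of $G$ is $p$-separable in $G$. -/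

import Mathlib

universe u v

/-- A subgroup `F` of a group `X` is `p`-separable (separable in the class of finite `p`-groups)
if for every `g ∈ X \ F` there is a homomorphism `ψ` of `X` onto a finite `p`-group such that
`ψ g ∉ ψ F`. -/
def IsPSeparable (p : ℕ) {X : Type u} [Group X] (F : Subgroup X) : Prop :=
  ∀ g : X, g ∉ F → ∃ (P : Type u) (_ : Group P) (ψ : X →* P),
    Finite P ∧ IsPGroup p P ∧ Function.Surjective ψ ∧ ψ g ∉ F.map ψ

/-- A group is residually `p`-finite if its trivial subgroup is `p`-separable. -/
def IsResiduallyPFinite (p : ℕ) (X : Type u) [Group X] : Prop :=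
  IsPSeparable p (⊥ : Subgroup X)

/-- A subgroup `Y` of `X` is `p'`-isolated if for all `g ∈ X` and all primes `q ≠ p`,
`g ^ q ∈ Y` implies `g ∈ Y`. -/
def IsPPrimeIsolated (p : ℕ) {X : Type u} [Group X] (Y : Subgroup X) : Prop :=
  ∀ (g : X) (q : ℕ), q.Prime → q ≠ p → g ^ q ∈ Y → g ∈ Y

/-- `C` is maximal, with respect to inclusion, among the infinite cyclic subgroups of `X`. -/
def IsMaximalInfiniteCyclic {X : Type u} [Group X] (C : Subgroup X) : Prop :=
  Maximal (fun D : Subgroup X => IsCyclic D ∧ Infinite D) C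

/-- The free product of `A` and `B` with the subgroups `H ≤ A` and `K ≤ B` amalgamated according
to the isomorphism `φ : H → K`: the quotient of the free product of `A` and `B` by the normal
closure of all elements `a * (φ a)⁻¹` with `a ∈ H`. -/
abbrev AmalgamatedProduct {A : Type u} {B : Type v} [Group A] [Group B]
    {H : Subgroup A} {K : Subgroup B} (φ : H ≃* K) : Type (max u v) :=
  Monoid.Coprod A B ⧸ Subgroup.normalClosure
    (Set.range fun a : H =>
      (Monoid.Coprod.inl (a : A) * (Monoid.Coprod.inr (φ a : B))⁻¹ : Monoid.Coprod A B))

/-!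
Separation from a cyclic subgroup `⟨f⟩` by finite `p`-quotients is proved in the form
`PSeparates p f g`, for elements `g` no power of which of exponent prime to `p` lies in `⟨f⟩`. If
`⟨f⟩` is `p'`-isolated, these are exactly the elements outside it. Three facts about a residually
`p`-finite group `X` reduce the problem: noncommuting `f` and `g` are separated by a quotient in
which their commutator survives (`PSeparates.of_not_commute`); elements `f` of finite order cause no
difficulty (`PSeparates.of_isOfFinOrder`); neither do elements `g` with `g ^ y ∈ ⟨f⟩` for some
`y ≠ 0` (`PSeparates.of_pow_mem`, reducing to `g ^ p ∈ ⟨f⟩`).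

Write the amalgamated product as a pushout. A normal subgroup `N` of `p`-power index gives a
homomorphism `amalgFold N` onto an amalgam of subgroups of the finite `p`-group `P = G ⧸ N`. Such an
amalgam embeds in the wreath product of a free group and `P` (`amalgToWreath_injective`): it is
residually `p`-finite, since free groups are, and any two commuting elements of it satisfy a
relation `f ^ x = g ^ y` with `x`, `y` not both zero, since it is virtually free. These properties pass to `G` provided that enough
subgroups `N` exist, which is expressed by `IsPAmalgam`. Commuting `f` and `g` are then treated
according to the reduced form of a conjugate of `f` (`IsPAmalgam.pSeparates`):

* If `f` is conjugate to a cyclically reduced word, it has infinite order modulo a suitable kernel,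
  where `f ^ x = g ^ y` for some `y ≠ 0`. If this holds in `G` as well, the third fact applies to `G`;
  otherwise it applies to an amalgam in which `f ^ x * g ^ (-y)` is nontrivial.
* If only `g` is conjugate to a cyclically reduced word, `f` has finite order in an amalgam of
  finite groups in which `g` has infinite order.
* If both are conjugate into factors, they are simultaneously conjugate into one factor
  (`exists_conj_mem_common_factor`), where separation is a property of finitely generated nilpotent
  groups (`Group.pSeparates_of_isNilpotent`).

The subgroups `N` come from the factors. In a finitely generated nilpotent group, the generator `c`
of the amalgamated subgroup has order exactly `p ^ e` in arbitrarily fine finite `p`-quotients, for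
every large `e` (`Group.exists_isPOpen_zpow_mem_iff`). Choosing the same `e` on both sides, Higman's
theorem (`embedsInFinitePGroup_of_orderOf_eq`) embeds the two quotients in a common finite `p`-group
compatibly with the identification. Maximality of `⟨h⟩` and `⟨k⟩`, together with the exponents being
powers of `p`, makes the amalgamated subgroups `p'`-isolated, hence closed in the factors.
-/

open scoped commutatorElement

/-! ### Normal subgroups of `p`-power index -/

/-- Normal subgroups of `p`-power index: the open normal subgroups of the pro-`p` topology. -/
structure Subgroup.IsPOpen (p : ℕ) {X : Type*} [Group X] (N : Subgroup X) : Prop where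
  normal : N.Normal
  index_eq : ∃ k, N.index = p ^ k

/-- Residual `p`-finiteness, in terms of normal subgroups of `p`-power index. -/
def IsPResidual (p : ℕ) (X : Type*) [Group X] : Prop :=
  ∀ x : X, x ≠ 1 → ∃ N : Subgroup X, N.IsPOpen p ∧ x ∉ N

/-- Some finite `p`-quotient maps `g` outside the image of the cyclic subgroup `⟨f⟩`. -/
def PSeparates (p : ℕ) {X : Type*} [Group X] (f g : X) : Prop :=
  ∃ N : Subgroup X, N.IsPOpen p ∧ ∀ i : ℤ, g * f ^ i ∉ N

namespace Subgroup.IsPOpen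

variable {p : ℕ} {X Y : Type*} [Group X] [Group Y]

theorem top : (⊤ : Subgroup X).IsPOpen p := ⟨inferInstance, 0, by simp⟩

theorem comap (hp : p.Prime) {N : Subgroup Y} (hN : N.IsPOpen p) (f : X →* Y) :
    (N.comap f).IsPOpen p := by
  have := hN.normal
  obtain ⟨k, hk⟩ := hN.index_eq
  refine ⟨inferInstance, ?_⟩
  rw [Subgroup.index_comap]
  obtain ⟨j, -, hj⟩ := (Nat.dvd_prime_pow hp).1 (hk ▸ Subgroup.relIndex_dvd_index_of_normal N f.range)
  exact ⟨j, hj⟩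

theorem inf (hp : p.Prime) {N M : Subgroup X} (hN : N.IsPOpen p) (hM : M.IsPOpen p) :
    (N ⊓ M).IsPOpen p := by
  have := hN.normal
  have := hM.normal
  obtain ⟨k, hk⟩ := hN.index_eq
  obtain ⟨l, hl⟩ := hM.index_eq
  refine ⟨inferInstance, ?_⟩
  have h1 : (N ⊓ M).index ∣ p ^ (k + l) := by
    rw [← Subgroup.relIndex_mul_index (inf_le_right : N ⊓ M ≤ M), Subgroup.inf_relIndex_right,
      pow_add, ← hk, ← hl]
    exact mul_dvd_mul_right (Subgroup.relIndex_dvd_index_of_normal N M) _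
  obtain ⟨j, -, hj⟩ := (Nat.dvd_prime_pow hp).1 h1
  exact ⟨j, hj⟩

theorem iInf (hp : p.Prime) {ι : Type*} (s : Finset ι) {N : ι → Subgroup X}
    (hN : ∀ i ∈ s, (N i).IsPOpen p) : (⨅ i ∈ s, N i).IsPOpen p := by
  classical
  induction s using Finset.induction_on with
  | empty => simpa using top
  | insert a s _ ih =>
    rw [Finset.iInf_insert]
    exact (hN a (by simp)).inf hp (ih fun i hi => hN i (by simp [hi]))

theorem ker (hp : p.Prime) [Finite Y] (hY : IsPGroup p Y) (f : X →* Y) : f.ker.IsPOpen p := by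
  have : Fact p.Prime := ⟨hp⟩
  refine ⟨inferInstance, ?_⟩
  rw [Subgroup.index_ker]
  exact IsPGroup.iff_card.1 (hY.to_subgroup f.range)

theorem finite_quotient (hp : p.Prime) {N : Subgroup X} (hN : N.IsPOpen p) : Finite (X ⧸ N) := by
  obtain ⟨k, hk⟩ := hN.index_eq
  have : N.FiniteIndex := ⟨by rw [hk]; exact (pow_pos hp.pos k).ne'⟩
  exact Subgroup.finite_quotient_of_finiteIndex

theorem pow_mem {N : Subgroup X} (hN : N.IsPOpen p) : ∃ k, ∀ x : X, x ^ p ^ k ∈ N := by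
  have := hN.normal
  obtain ⟨k, hk⟩ := hN.index_eq
  exact ⟨k, fun x => hk ▸ Subgroup.pow_index_mem N x⟩

theorem isPGroup_quotient {N : Subgroup X} [N.Normal] (hN : N.IsPOpen p) : IsPGroup p (X ⧸ N) := by
  obtain ⟨k, hk⟩ := hN.pow_mem
  intro x
  obtain ⟨x, rfl⟩ := QuotientGroup.mk_surjective x
  exact ⟨k, by rw [← QuotientGroup.mk_pow, QuotientGroup.eq_one_iff]; exact hk x⟩

/-- A coprime-to-`p` power lies in `N` only if the element does. -/
theorem mem_of_zpow_mem {N : Subgroup X} (hN : N.IsPOpen p) {x : X} {q : ℤ}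
    (hq : IsCoprime q p) (hx : x ^ q ∈ N) : x ∈ N := by
  obtain ⟨k, hk⟩ := hN.pow_mem
  obtain ⟨u, v, huv⟩ := hq.pow_right (n := k)
  have : x = (x ^ q) ^ u * (x ^ p ^ k) ^ v := by
    rw [← zpow_natCast x, ← zpow_mul, ← zpow_mul, ← zpow_add, mul_comm q, mul_comm _ v]
    push_cast
    rw [huv, zpow_one]
  rw [this]
  exact mul_mem (zpow_mem hx _) (zpow_mem (hk x) _)

end Subgroup.IsPOpen

section Separation

variable {p : ℕ} {X Y : Type*} [Group X] [Group Y]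

theorem PSeparates.comap (hp : p.Prime) (φ : X →* Y) {f g : X} (h : PSeparates p (φ f) (φ g)) :
    PSeparates p f g := by
  obtain ⟨N, hN, h⟩ := h
  exact ⟨N.comap φ, hN.comap hp φ, fun i hi => h i (by simpa using hi)⟩

theorem PSeparates.of_conj (hp : p.Prime) (c : X) {f g : X}
    (h : PSeparates p (c * f * c⁻¹) (c * g * c⁻¹)) : PSeparates p f g :=
  PSeparates.comap hp (MulAut.conj c).toMonoidHom h

/-- Multiplying `g` by a power of `f` does not affect separation. -/
theorem PSeparates.of_mul_zpow {f g : X} (j : ℤ) (h : PSeparates p f (g * f ^ j)) :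
    PSeparates p f g := by
  obtain ⟨N, hN, h⟩ := h
  refine ⟨N, hN, fun i hi => h (i - j) ?_⟩
  rwa [mul_assoc, ← zpow_add, add_sub_cancel]

theorem PSeparates.of_pow {f g : X} (hc : Commute f g) (k : ℕ) (h : PSeparates p f (g ^ k)) :
    PSeparates p f g := by
  obtain ⟨N, hN, h⟩ := h
  refine ⟨N, hN, fun i hi => h (i * k) ?_⟩
  have := N.pow_mem hi k
  rwa [(hc.symm.zpow_right i).mul_pow, ← zpow_natCast (f ^ i), ← zpow_mul] at this

theorem IsPResidual.eq_one_of_zpow_eq_one (hX : IsPResidual p X) {x : X} {q : ℤ}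
    (hq : IsCoprime q p) (hx : x ^ q = 1) : x = 1 := by
  by_contra h
  obtain ⟨N, hN, hxN⟩ := hX x h
  exact hxN (hN.mem_of_zpow_mem hq (hx ▸ one_mem N))

theorem PSeparates.of_not_commute (hX : IsPResidual p X) {f g : X}
    (h : ¬ Commute f g) : PSeparates p f g := by
  obtain ⟨N, hN, hf⟩ := hX ⁅f, g⁆ (by rwa [Ne, commutatorElement_eq_one_iff_commute])
  have := hN.normal
  refine ⟨N, hN, fun i hi => hf ?_⟩
  rw [← QuotientGroup.eq_one_iff] at hi ⊢
  rw [QuotientGroup.mk_mul, mul_eq_one_iff_eq_inv, QuotientGroup.mk_zpow, ← zpow_neg] at hi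
  rw [← QuotientGroup.mk'_apply, map_commutatorElement,
    commutatorElement_eq_one_iff_commute, QuotientGroup.mk'_apply, QuotientGroup.mk'_apply, hi]
  exact Commute.self_zpow _ _

theorem IsPResidual.exists_inter (hp : p.Prime) (hX : IsPResidual p X) {s : Set X}
    (hs : s.Finite) (h1 : (1 : X) ∉ s) :
    ∃ N : Subgroup X, N.IsPOpen p ∧ ∀ x ∈ s, x ∉ N := by
  classical
  choose! N hN hxN using hX
  refine ⟨⨅ x ∈ hs.toFinset, N x, .iInf hp _ fun x hx => hN x ?_, fun x hx h => ?_⟩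
  · rintro rfl
    exact h1 (by simpa using hx)
  · refine hxN x (fun h' => h1 (h' ▸ hx)) ?_
    simp only [Subgroup.mem_iInf] at h
    exact h x (by simpa using hx)

theorem PSeparates.of_isOfFinOrder (hp : p.Prime) (hX : IsPResidual p X) {f g : X}
    (hf : IsOfFinOrder f) (hg : g ∉ Subgroup.zpowers f) : PSeparates p f g := by
  have hfin : (Set.range fun i : ℤ => g * f ^ i).Finite := by
    have : (Subgroup.zpowers f : Set X).Finite := by
      simpa using hf
    refine (this.image (g * ·)).subset ?_
    rintro _ ⟨i, rfl⟩
    exact ⟨f ^ i, ⟨i, rfl⟩, rfl⟩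
  obtain ⟨N, hN, h⟩ := hX.exists_inter hp hfin (by
    rintro ⟨i, hi⟩
    exact hg ⟨-i, by simpa using (eq_inv_of_mul_eq_one_left hi).symm⟩)
  exact ⟨N, hN, fun i => h _ ⟨i, rfl⟩⟩

end Separation

/-! ### Separating roots of elements of a cyclic subgroup -/

section RootSeparation

variable {p : ℕ} {X : Type*} [Group X]

/-- If `z` has order `p` and commutes with `f` of infinite order, a residually `p`-finite group
separates `z` from `⟨f⟩`: an open `N` with `z ∉ N` meets `⟨f, z⟩` in an infinite cyclic group
`⟨w⟩`, and an open subgroup of `N` missing `w` meets it in a subgroup of `⟨w ^ p⟩ ≤ ⟨f⟩`. -/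
theorem PSeparates.of_pow_eq_one (hp : p.Prime) (hX : IsPResidual p X) {f z : X}
    (hc : Commute f z) (hf : ¬ IsOfFinOrder f) (hz : z ≠ 1) (hzp : z ^ p = 1) :
    PSeparates p f z := by
  have hord : orderOf z = p := orderOf_eq_prime (hp := ⟨hp⟩) hzp hz
  obtain ⟨N, hN, hzN⟩ := hX z hz
  have := hN.normal
  -- The exponents `r` such that `f ^ r` lies in `N ⟨z⟩`.
  let R : AddSubgroup ℤ :=
    { carrier := {r | ∃ t : ℤ, f ^ r * z ^ t ∈ N}
      zero_mem' := ⟨0, by simp⟩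
      add_mem' := by
        rintro a b ⟨s, hs⟩ ⟨t, ht⟩
        refine ⟨s + t, ?_⟩
        have := mul_mem hs ht
        rwa [mul_assoc, ← mul_assoc (z ^ s), ((hc.symm.zpow_zpow s b)).eq, mul_assoc, ← zpow_add,
          ← mul_assoc, ← zpow_add] at this
      neg_mem' := by
        rintro a ⟨s, hs⟩
        refine ⟨-s, ?_⟩
        have := inv_mem hs
        rwa [mul_inv_rev, ← zpow_neg, ← zpow_neg, ((hc.symm.zpow_zpow (-s) (-a))).eq] at this }
  obtain ⟨r, hr⟩ := Int.subgroup_cyclic R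
  have hrR : r ∈ R := hr ▸ AddSubgroup.subset_closure rfl
  obtain ⟨t, ht⟩ := hrR
  have hr0 : r ≠ 0 := by
    rintro rfl
    obtain ⟨k, hk⟩ := hN.pow_mem
    have : ((p ^ k : ℕ) : ℤ) ∈ R := ⟨0, by rw [zpow_zero, mul_one, zpow_natCast]; exact hk f⟩
    rw [hr] at this
    simp [AddSubgroup.mem_closure_singleton] at this
    exact pow_ne_zero k (Nat.cast_ne_zero.2 hp.ne_zero) this.symm
  set w := f ^ r * z ^ t with hw
  have hwpow : ∀ i : ℤ, w ^ i = f ^ (r * i) * z ^ (t * i) := fun i => by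
    rw [hw, (hc.zpow_zpow r t).mul_zpow, zpow_mul, zpow_mul]
  have hw1 : w ≠ 1 := by
    intro h
    have := hwpow p
    rw [h, one_zpow, mul_comm t, zpow_mul z, zpow_natCast z, hzp, one_zpow, mul_one] at this
    exact hf (isOfFinOrder_iff_zpow_eq_one.2 ⟨r * p, mul_ne_zero hr0 (by exact_mod_cast hp.ne_zero), this.symm⟩)
  obtain ⟨N', hN', hwN'⟩ := hX w hw1
  have := hN'.normal
  refine ⟨N ⊓ N', hN.inf hp hN', fun i ⟨hi, hi'⟩ => ?_⟩
  have hiR : i ∈ R := ⟨1, by rw [zpow_one, ← (hc.symm.zpow_right i).eq]; exact hi⟩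
  rw [hr, AddSubgroup.mem_closure_singleton] at hiR
  obtain ⟨j, rfl⟩ := hiR
  have hdiff : z * f ^ (j • r) = z ^ (1 - t * j) * w ^ j := by
    rw [hwpow, smul_eq_mul, mul_comm j r, ← mul_assoc, (hc.symm.zpow_zpow (1 - t * j) (r * j)).eq,
      mul_assoc, ← zpow_add, sub_add_cancel, zpow_one, (hc.symm.zpow_right _).eq]
  have hzN2 : z ^ (1 - t * j) ∈ N := by
    rw [hdiff] at hi
    exact (mul_mem_cancel_right (zpow_mem ht j)).1 hi
  have hpdvd : (p : ℤ) ∣ 1 - t * j := by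
    by_contra h
    exact hzN (hN.mem_of_zpow_mem (((Nat.prime_iff_prime_int.1 hp).coprime_iff_not_dvd.2 h).symm) hzN2)
  have hz1 : z ^ (1 - t * j) = 1 := by
    rw [← orderOf_dvd_iff_zpow_eq_one, hord]; exact hpdvd
  rw [hdiff, hz1, one_mul] at hi'
  refine hwN' (hN'.mem_of_zpow_mem ?_ hi')
  obtain ⟨c, hc⟩ := hpdvd
  exact ⟨t, c, by linarith [mul_comm c (p:ℤ)]⟩

theorem PSeparates.of_prime_pow_mem (hp : p.Prime) (hX : IsPResidual p X) {f g : X}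
    (hc : Commute f g) (hg : g ∉ Subgroup.zpowers f) (hgp : g ^ p ∈ Subgroup.zpowers f) :
    PSeparates p f g := by
  by_cases hf : IsOfFinOrder f
  · exact .of_isOfFinOrder hp hX hf hg
  obtain ⟨i, hi : f ^ i = g ^ p⟩ := hgp
  by_cases hpi : (p : ℤ) ∣ i
  · obtain ⟨j, rfl⟩ := hpi
    refine .of_mul_zpow (-j) (.of_pow_eq_one hp hX ?_ hf ?_ ?_)
    · exact hc.mul_right (Commute.self_zpow f _)
    · exact fun h => hg ⟨j, by simpa using (eq_inv_of_mul_eq_one_left h).symm⟩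
    · rw [(hc.symm.zpow_right _).mul_pow, ← hi, ← zpow_natCast (f ^ _), ← zpow_mul, ← zpow_add]
      simp [mul_comm]
  · -- Here `⟨f, g⟩` is cyclic, generated by a `p`-th root `e` of `f`.
    obtain ⟨u, v, huv⟩ : IsCoprime i p :=
      ((Nat.prime_iff_prime_int.1 hp).coprime_iff_not_dvd.2 hpi).symm
    have hcz : ∀ a b : ℤ, Commute (g ^ a) (f ^ b) := fun a b => hc.symm.zpow_zpow a b
    set e := g ^ u * f ^ v with he
    have hgp' : g ^ (p : ℤ) = f ^ i := by rw [hi, zpow_natCast]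
    have hef : e ^ (p : ℤ) = f := by
      rw [he, (hcz u v).mul_zpow, ← zpow_mul, mul_comm u, zpow_mul, hgp', ← zpow_mul, ← zpow_mul,
        ← zpow_add, mul_comm i u, huv, zpow_one]
    have heg : e ^ i = g := by
      rw [he, (hcz u v).mul_zpow, ← zpow_mul, ← zpow_mul, mul_comm v, zpow_mul f, ← hgp',
        ← zpow_mul, ← zpow_add, mul_comm (p : ℤ), huv, zpow_one]
    have he1 : e ≠ 1 := by
      rintro h
      rw [h, one_zpow] at heg
      exact hg (heg ▸ one_mem _)
    obtain ⟨N, hN, heN⟩ := hX e he1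
    refine ⟨N, hN, fun j hj => heN (hN.mem_of_zpow_mem (q := i + p * j) ⟨u, v - u * j, ?_⟩ ?_)⟩
    · linear_combination huv
    · rwa [zpow_add, zpow_mul, hef, heg]

/-- In a residually `p`-finite group, `g` is separated from `⟨f⟩` as soon as it is a root of an
element of `⟨f⟩` but no power of `g` prime to `p` lies in `⟨f⟩`. -/
theorem PSeparates.of_pow_mem (hp : p.Prime) (hX : IsPResidual p X) {f g : X}
    (hc : Commute f g) {y : ℤ} (hy : y ≠ 0) (hgy : g ^ y ∈ Subgroup.zpowers f)
    (hg : ∀ q : ℕ, q.Coprime p → g ^ q ∉ Subgroup.zpowers f) : PSeparates p f g := by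
  have hgy' : g ^ y.natAbs ∈ Subgroup.zpowers f := by
    rw [← zpow_natCast]
    rcases Int.natAbs_eq y with h | h <;> rw [h] at hgy
    · exact hgy
    · simpa only [zpow_neg, inv_mem_iff] using hgy
  obtain ⟨a, q, hq, haq⟩ := Nat.exists_eq_pow_mul_and_not_dvd (Int.natAbs_ne_zero.2 hy) p hp.ne_one
  have hqp : q.Coprime p := ((hp.coprime_iff_not_dvd).2 hq).symm
  have hex : ∃ b, (g ^ q) ^ p ^ b ∈ Subgroup.zpowers f :=
    ⟨a, by rwa [← pow_mul, mul_comm, ← haq]⟩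
  classical
  refine .of_pow hc q ?_
  obtain ⟨b, hb⟩ : ∃ b, Nat.find hex = b + 1 := Nat.exists_eq_succ_of_ne_zero fun h0 => by
    have := Nat.find_spec hex
    rw [h0, pow_zero, pow_one] at this
    exact hg q hqp this
  have hc' : Commute f ((g ^ q) ^ p ^ b) := (hc.pow_right q).pow_right _
  refine .of_pow (hc.pow_right q) (p ^ b) (.of_prime_pow_mem hp hX hc' ?_ ?_)
  · exact Nat.find_min hex (by omega)
  · rw [← pow_mul, ← pow_succ, ← hb]
    exact Nat.find_spec hex

end RootSeparation

/-! ### Finitely generated nilpotent groups -/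

section Noetherian

variable {G Q : Type*} [Group G] [Group Q]

theorem Subgroup.fg_of_map_of_inf_ker (f : G →* Q) {H : Subgroup G} (h1 : (H.map f).FG)
    (h2 : (H ⊓ f.ker).FG) : H.FG := by
  classical
  obtain ⟨S, hS, hSfin⟩ := (Subgroup.fg_iff _).1 h1
  have hlift : ∀ q ∈ S, ∃ x ∈ H, f x = q := fun q hq =>
    (hS ▸ Subgroup.subset_closure hq : q ∈ H.map f)
  choose! t htH htf using hlift
  have hT : Subgroup.closure (t '' S) ≤ H :=
    (Subgroup.closure_le _).2 (by rintro _ ⟨q, hq, rfl⟩; exact htH q hq)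
  have key : H = Subgroup.closure (t '' S) ⊔ (H ⊓ f.ker) := by
    refine le_antisymm (fun x hx => ?_) (sup_le hT inf_le_left)
    have hx' : f x ∈ (Subgroup.closure (t '' S)).map f := by
      have : f '' (t '' S) = S := by
        rw [Set.image_image, Set.image_congr (g := id) (fun q hq => htf q hq), Set.image_id]
      rw [MonoidHom.map_closure, this, hS]
      exact ⟨x, hx, rfl⟩
    obtain ⟨y, hy, hyx⟩ := hx'
    rw [← mul_inv_cancel_left y x]
    refine mul_mem (le_sup_left (a := Subgroup.closure (t '' S)) hy)
      (le_sup_right (b := H ⊓ f.ker) (Subgroup.mem_inf.2 ⟨mul_mem (inv_mem (hT hy)) hx, ?_⟩))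
    rw [MonoidHom.mem_ker, map_mul, map_inv, hyx, inv_mul_cancel]
  rw [key]
  exact Subgroup.FG.sup ((Subgroup.fg_iff _).2 ⟨_, rfl, hSfin.image t⟩) h2

theorem CommGroup.subgroup_fg {M : Type*} [CommGroup M] [Group.FG M] (H : Subgroup M) : H.FG := by
  have : Module.Finite ℤ (Additive M) := Module.Finite.iff_addGroup_fg.2 inferInstance
  have := isNoetherian_of_isNoetherianRing_of_finite ℤ (Additive M)
  rw [Subgroup.fg_iff_add_fg, ← AddSubgroup.toIntSubmodule_toAddSubgroup H.toAddSubgroup,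
    ← Submodule.fg_iff_addSubgroup_fg]
  exact IsNoetherian.noetherian _

theorem Subgroup.fg_of_le_center {N H : Subgroup G} (hN : N ≤ Subgroup.center G) (hfg : N.FG)
    (hH : H ≤ N) : H.FG := by
  let _ : CommGroup N :=
    { (inferInstance : Group N) with
      mul_comm := fun a b => Subtype.ext (Subgroup.mem_center_iff.1 (hN b.2) a) }
  have : Group.FG N := (Group.fg_iff_subgroup_fg N).2 hfg
  have : (H.subgroupOf N).FG := CommGroup.subgroup_fg (H.subgroupOf N)
  rw [← Subgroup.subgroupOf_map_subtype H N |>.trans (inf_eq_left.2 hH)]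
  obtain ⟨S, hS⟩ := this
  classical
  exact ⟨S.image N.subtype, by rw [Finset.coe_image, ← MonoidHom.map_closure, hS]⟩

/-- If all commutators of `M` with `G` are central, then `⁅x, y⁆` is multiplicative in `x ∈ M` and in
`y`, so `⁅M, G⁆` is generated by the commutators of generators. -/
theorem Subgroup.fg_commutator_top [Group.FG G] {M N : Subgroup G} [N.Normal]
    (hM : (M.map (QuotientGroup.mk' N)).FG) (hN : N ≤ Subgroup.center G)
    (hZ : ⁅M, (⊤ : Subgroup G)⁆ ≤ Subgroup.center G) : (⁅M, (⊤ : Subgroup G)⁆).FG := by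
  classical
  obtain ⟨S, hS, hSfin⟩ := Group.fg_iff.1 (inferInstance : Group.FG G)
  obtain ⟨T, hT, hTfin⟩ := (Subgroup.fg_iff _).1 hM
  have hlift : ∀ q ∈ T, ∃ x ∈ M, QuotientGroup.mk' N x = q := fun q hq =>
    (hT ▸ Subgroup.subset_closure hq : q ∈ M.map _)
  choose! t htM htq using hlift
  have hcen : ∀ x ∈ M, ∀ y : G, ⁅x, y⁆ ∈ Subgroup.center G := fun x hx y =>
    hZ (Subgroup.commutator_mem_commutator hx (Subgroup.mem_top y))
  let W : Set G := (fun q : G × G => ⁅q.1, q.2⁆) '' ((t '' T) ×ˢ S)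
  have hW : ∀ x ∈ T, ∀ y ∈ S, ⁅t x, y⁆ ∈ Subgroup.closure W := fun x hx y hy =>
    Subgroup.subset_closure ⟨(t x, y), ⟨⟨x, hx, rfl⟩, hy⟩, rfl⟩
  have hmulr : ∀ x ∈ M, ∀ y z : G, ⁅x, y * z⁆ = ⁅x, y⁆ * ⁅x, z⁆ := fun x hx y z => by
    have h := Subgroup.mem_center_iff.1 (hcen x hx z) y
    rw [commutatorElement_def x (y * z), commutatorElement_def x y, mul_inv_rev]
    calc x * (y * z) * x⁻¹ * (z⁻¹ * y⁻¹) = x * y * x⁻¹ * (⁅x, z⁆ * y⁻¹) := by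
          rw [commutatorElement_def]; group
      _ = x * y * x⁻¹ * (y⁻¹ * ⁅x, z⁆) := by
          rw [(Subgroup.mem_center_iff.1 (hcen x hx z) y⁻¹)]
      _ = _ := by group
  have hmull : ∀ x ∈ M, ∀ z ∈ M, ∀ y : G, ⁅x * z, y⁆ = ⁅x, y⁆ * ⁅z, y⁆ := fun x hx z hz y => by
    calc ⁅x * z, y⁆ = x * ⁅z, y⁆ * y * x⁻¹ * y⁻¹ := by
          rw [commutatorElement_def, commutatorElement_def]; group
      _ = ⁅z, y⁆ * x * y * x⁻¹ * y⁻¹ := by rw [Subgroup.mem_center_iff.1 (hcen z hz y) x]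
      _ = ⁅z, y⁆ * ⁅x, y⁆ := by rw [commutatorElement_def x y]; group
      _ = _ := Subgroup.mem_center_iff.1 (hcen x hx y) _
  have hone : ∀ x ∈ M, ∀ y, y ∈ Subgroup.center G → ⁅x, y⁆ = 1 := fun x _ y hy =>
    commutatorElement_eq_one_iff_mul_comm.2 (Subgroup.mem_center_iff.1 hy x)
  have hright : ∀ x ∈ T, ∀ y : G, ⁅t x, y⁆ ∈ Subgroup.closure W := fun x hx y => by
    have hy : y ∈ Subgroup.closure S := hS ▸ Subgroup.mem_top y
    induction hy using Subgroup.closure_induction with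
    | mem y hy => exact hW x hx y hy
    | one => rw [commutatorElement_one_right]; exact one_mem _
    | mul y z _ _ hy hz => rw [hmulr _ (htM x hx)]; exact mul_mem hy hz
    | inv y _ hy =>
      have := hmulr _ (htM x hx) y y⁻¹
      rw [mul_inv_cancel, commutatorElement_one_right] at this
      rw [← inv_eq_of_mul_eq_one_right this.symm]
      exact inv_mem hy
  have hclosM : Subgroup.closure (t '' T) ≤ M :=
    (Subgroup.closure_le _).2 (by rintro _ ⟨q, hq, rfl⟩; exact htM q hq)
  have hclos : ∀ x ∈ Subgroup.closure (t '' T), ∀ y : G, ⁅x, y⁆ ∈ Subgroup.closure W := by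
    intro x hx y
    induction hx using Subgroup.closure_induction with
    | mem x hx => obtain ⟨q, hq, rfl⟩ := hx; exact hright q hq y
    | one => rw [commutatorElement_one_left]; exact one_mem _
    | mul x z hx' hz' hx hz => rw [hmull _ (hclosM hx') _ (hclosM hz')]; exact mul_mem hx hz
    | inv x hx' hx =>
      have := hmull _ (hclosM hx') _ (inv_mem (hclosM hx')) y
      rw [mul_inv_cancel, commutatorElement_one_left] at this
      rw [← inv_eq_of_mul_eq_one_right this.symm]
      exact inv_mem hx
  have hle : ⁅M, (⊤ : Subgroup G)⁆ ≤ Subgroup.closure W := by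
    refine Subgroup.commutator_le.2 fun x hx y _ => ?_
    have hx' : QuotientGroup.mk' N x ∈ (Subgroup.closure (t '' T)).map (QuotientGroup.mk' N) := by
      have : QuotientGroup.mk' N '' (t '' T) = T := by
        rw [Set.image_image, Set.image_congr (g := id) (fun q hq => htq q hq), Set.image_id]
      rw [MonoidHom.map_closure, this, hT]
      exact ⟨x, hx, rfl⟩
    obtain ⟨z, hz, hzx⟩ := hx'
    have hn : z⁻¹ * x ∈ Subgroup.center G := hN (QuotientGroup.eq.1 hzx)
    rw [← mul_inv_cancel_left z x, hmull z (hclosM hz) _ (mul_mem (inv_mem (hclosM hz)) hx),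
      commutatorElement_eq_one_iff_mul_comm.2 (Subgroup.mem_center_iff.1 hn y).symm, mul_one]
    exact hclos z hz y
  refine (Subgroup.fg_iff _).2 ⟨W, le_antisymm ((Subgroup.closure_le _).2 ?_) hle,
    ((hTfin.image t).prod hSfin).image _⟩
  rintro _ ⟨⟨_, y⟩, ⟨⟨q, hq, rfl⟩, _⟩, rfl⟩
  exact Subgroup.commutator_mem_commutator (htM q hq) (Subgroup.mem_top y)

theorem Subgroup.fg_of_lowerCentralSeries_eq_bot (n : ℕ) : ∀ (G : Type u) [Group G] [Group.FG G],
    (⊤ : Subgroup G).lowerCentralSeries n = ⊥ → ∀ H : Subgroup G, H.FG := by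
  induction n with
  | zero =>
    intro G _ _ h H
    rw [Subgroup.lowerCentralSeries_zero] at h
    rw [eq_bot_iff.2 ((le_top : H ≤ ⊤).trans h.le)]
    exact Subgroup.FG.bot
  | succ n ih =>
    intro G _ _ h H
    set N := (⊤ : Subgroup G).lowerCentralSeries n with hN
    have hNc : N ≤ Subgroup.center G := fun x hx => Subgroup.mem_center_iff.2 fun y => by
      have : ⁅x, y⁆ ∈ (⊤ : Subgroup G).lowerCentralSeries (n + 1) :=
        Subgroup.commutator_mem_commutator hx (Subgroup.mem_top y)
      rw [h, Subgroup.mem_bot, commutatorElement_eq_one_iff_mul_comm] at this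
      exact this.symm
    have hQ : (⊤ : Subgroup (G ⧸ N)).lowerCentralSeries n = ⊥ := by
      rw [← Subgroup.map_top_of_surjective _ (QuotientGroup.mk'_surjective N),
        ← Subgroup.map_lowerCentralSeries, ← hN, QuotientGroup.map_mk'_self]
    have hNfg : N.FG := by
      cases n with
      | zero => exact Group.fg_def.1 inferInstance
      | succ m => exact Subgroup.fg_commutator_top (ih _ hQ _) hNc hNc
    refine Subgroup.fg_of_map_of_inf_ker (QuotientGroup.mk' N) (ih _ hQ _) ?_
    rw [QuotientGroup.ker_mk']
    exact Subgroup.fg_of_le_center hNc hNfg inf_le_right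

/-- Finitely generated nilpotent groups satisfy the maximal condition on subgroups. -/
theorem Subgroup.fg_of_isNilpotent [Group.FG G] [Group.IsNilpotent G] (H : Subgroup G) : H.FG := by
  obtain ⟨n, hn⟩ := Subgroup.nilpotent_iff_lowerCentralSeries.1 (inferInstance : Group.IsNilpotent G)
  exact Subgroup.fg_of_lowerCentralSeries_eq_bot n G hn H

theorem Group.finite_of_finite_center (G : Type u) [Group G] [Group.IsNilpotent G] :
    Group.FG G → Finite (Subgroup.center G) → Finite G := by
  refine Group.nilpotent_center_quotient_ind
    (P := fun G _ _ => Group.FG G → Finite (Subgroup.center G) → Finite G) G ?_ ?_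
  · intros; infer_instance
  · intro G _ _ ih hfg hfin
    obtain ⟨S, hS, hSfin⟩ := Group.fg_iff.1 hfg
    have := hSfin.to_subtype
    let Z := Subgroup.center G
    have hcomm : ∀ x : Subgroup.center (G ⧸ Z), ∀ y : G, ⁅(x : G ⧸ Z).out, y⁆ ∈ Z := fun x y => by
      rw [← QuotientGroup.eq_one_iff, ← QuotientGroup.mk'_apply, map_commutatorElement,
        commutatorElement_eq_one_iff_mul_comm, QuotientGroup.mk'_apply, QuotientGroup.mk'_apply,
        QuotientGroup.out_eq']
      exact (Subgroup.mem_center_iff.1 x.2 _).symm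
    have hfin' : Finite (Subgroup.center (G ⧸ Z)) := by
      refine Finite.of_injective
        (fun (x : Subgroup.center (G ⧸ Z)) (y : S) => (⟨⁅(x : G ⧸ Z).out, (y : G)⁆, hcomm x y⟩ : Z))
        fun x x' hxx' => ?_
      have hy : ∀ y ∈ S, (x : G ⧸ Z).out * y * (x : G ⧸ Z).out⁻¹ =
          (x' : G ⧸ Z).out * y * (x' : G ⧸ Z).out⁻¹ := fun y hy => by
        have := congrArg Subtype.val (congrFun hxx' ⟨y, hy⟩)
        simpa [commutatorElement_def] using this
      have hcen : (x : G ⧸ Z).out⁻¹ * (x' : G ⧸ Z).out ∈ Z := by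
        have : Subgroup.closure S ≤ Subgroup.centralizer {(x : G ⧸ Z).out⁻¹ * (x' : G ⧸ Z).out} := by
          refine (Subgroup.closure_le _).2 fun y hyS => ?_
          rw [SetLike.mem_coe, Subgroup.mem_centralizer_singleton_iff]
          have h2 : (x' : G ⧸ Z).out * y =
              (x : G ⧸ Z).out * y * (x : G ⧸ Z).out⁻¹ * (x' : G ⧸ Z).out := by
            rw [hy y hyS]; group
          rw [mul_assoc _ _ y, h2]
          group
        rw [hS] at this
        refine Subgroup.mem_center_iff.2 fun y => ?_
        exact Subgroup.mem_centralizer_singleton_iff.1 (this (Subgroup.mem_top y))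
      exact Subtype.ext (by simpa using QuotientGroup.eq.2 hcen)
    have := ih inferInstance hfin'
    exact Finite.of_subgroup_quotient Z

theorem Group.exists_mem_center_not_isOfFinOrder [Group.FG G] [Group.IsNilpotent G] [Infinite G] :
    ∃ z ∈ Subgroup.center G, ¬ IsOfFinOrder z := by
  by_contra! h
  have hfg : Group.FG (Subgroup.center G) :=
    (Group.fg_iff_subgroup_fg _).2 (Subgroup.fg_of_isNilpotent _)
  let _ : CommGroup (Subgroup.center G) :=
    { (inferInstance : Group (Subgroup.center G)) with
      mul_comm := fun a b => Subtype.ext (Subgroup.mem_center_iff.1 b.2 a) }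
  have : Finite (Subgroup.center G) := CommGroup.finite_of_fg_isMulTorsion _ fun z =>
    Submonoid.isOfFinOrder_coe.1 (h z z.2)
  exact not_finite_iff_infinite.2 ‹Infinite G› (Group.finite_of_finite_center G ‹_› this)

end Noetherian

/-! ### Isolated subgroups of nilpotent groups -/

section Isolated

variable {p : ℕ} {G : Type*} [Group G]

theorem IsPPrimeIsolated.mem_of_pow_mem {Y : Subgroup G} (hY : IsPPrimeIsolated p Y) {q : ℕ}
    (hq : q.Coprime p) (hp : p ≠ 1) {g : G} (hg : g ^ q ∈ Y) : g ∈ Y := by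
  induction q using induction_on_primes generalizing g with
  | zero => exact absurd (by simpa using hq) hp
  | one => simpa using hg
  | prime_mul l q hl ih =>
    have hlp := hq.coprime_mul_right
    rw [mul_comm, pow_mul] at hg
    refine ih hq.coprime_mul_left (hY _ l hl ?_ hg)
    rintro rfl
    exact hp (by simpa using hlp)

theorem IsPResidual.isolated_bot (hp : p.Prime) (hG : IsPResidual p G) :
    IsPPrimeIsolated p (⊥ : Subgroup G) := fun g q hq hqp hg => by
  rw [Subgroup.mem_bot] at hg ⊢
  refine hG.eq_one_of_zpow_eq_one (q := q) ?_ (by simpa using hg)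
  exact Nat.isCoprime_iff_coprime.2 ((Nat.coprime_primes hq hp).2 hqp)

theorem IsPPrimeIsolated.isolated_bot_quotient {N : Subgroup G} [N.Normal]
    (hN : IsPPrimeIsolated p N) : IsPPrimeIsolated p (⊥ : Subgroup (G ⧸ N)) := fun g q hq hqp hg => by
  obtain ⟨g, rfl⟩ := QuotientGroup.mk_surjective g
  rw [Subgroup.mem_bot, ← QuotientGroup.mk_pow, QuotientGroup.eq_one_iff] at hg
  rw [Subgroup.mem_bot, QuotientGroup.eq_one_iff]
  exact hN g q hq hqp hg

theorem IsPPrimeIsolated.comap {Q : Type*} [Group Q] {Y : Subgroup Q} (hY : IsPPrimeIsolated p Y)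
    (f : G →* Q) : IsPPrimeIsolated p (Y.comap f) := fun g q hq hqp hg =>
  hY (f g) q hq hqp (by simpa using hg)

theorem commutatorElement_pow_left {x y : G} (h : Commute x ⁅x, y⁆) (n : ℕ) :
    ⁅x ^ n, y⁆ = ⁅x, y⁆ ^ n := by
  induction n with
  | zero => simp
  | succ n ih =>
    have h1 : ⁅x ^ (n + 1), y⁆ = x ^ n * ⁅x, y⁆ * (x ^ n)⁻¹ * ⁅x ^ n, y⁆ := by
      rw [commutatorElement_def, commutatorElement_def, commutatorElement_def, pow_succ]
      group
    rw [h1, (h.pow_left n).eq, mul_inv_cancel_right, ih, ← pow_succ']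

/-- Without `q`-torsion in `G` there is none in the factors of the upper central series: modulo the
previous term, `⁅x, y⁆ ^ q = ⁅x ^ q, y⁆`. -/
theorem Subgroup.mem_upperCentralSeries_of_pow_mem (hG : IsPPrimeIsolated p (⊥ : Subgroup G)) {q : ℕ}
    (hq : q.Prime) (hqp : q ≠ p) (n : ℕ) : ∀ x ∈ Subgroup.upperCentralSeries G (n + 1),
      x ^ q ∈ Subgroup.upperCentralSeries G n → x ∈ Subgroup.upperCentralSeries G n := by
  induction n with
  | zero => exact fun x _ hx => hG x q hq hqp hx
  | succ n ih =>
    intro x hx hxq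
    rw [Subgroup.mem_upperCentralSeries_succ_iff] at hx hxq ⊢
    intro y
    refine ih _ (hx y) ?_
    set N := Subgroup.upperCentralSeries G n with hN
    have hcomm : ∀ z, ⁅⁅x, y⁆, z⁆ ∈ N := Subgroup.mem_upperCentralSeries_succ_iff.1 (hx y)
    have h1 := hxq y
    rw [← QuotientGroup.eq_one_iff, ← QuotientGroup.mk'_apply] at h1 ⊢
    rw [map_commutatorElement, map_pow, commutatorElement_pow_left] at h1
    · rw [map_pow, map_commutatorElement, h1]
    · refine (commutatorElement_eq_one_iff_mul_comm.1 ?_).symm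
      rw [← map_commutatorElement, ← map_commutatorElement, QuotientGroup.mk'_apply,
        QuotientGroup.eq_one_iff]
      exact hcomm x

theorem IsPPrimeIsolated.center [Group.IsNilpotent G] (hG : IsPPrimeIsolated p (⊥ : Subgroup G)) :
    IsPPrimeIsolated p (Subgroup.center G) := by
  intro x q hq hqp hx
  rw [← Subgroup.upperCentralSeries_one] at hx ⊢
  have key : ∀ n, x ∈ Subgroup.upperCentralSeries G (n + 1) → x ∈ Subgroup.upperCentralSeries G 1 := by
    intro n
    induction n with
    | zero => exact id
    | succ n ih =>
      exact fun h => ih (Subgroup.mem_upperCentralSeries_of_pow_mem hG hq hqp (n + 1) x h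
        (Subgroup.upperCentralSeries_mono (G := G) (by omega) hx))
  obtain ⟨n, hn⟩ := Group.IsNilpotent.nilpotent G
  exact key n (Subgroup.upperCentralSeries_mono (G := G) (Nat.le_succ n) (hn ▸ Subgroup.mem_top x))

/-- The `p'`-isolator of the cyclic subgroup `⟨d⟩` inside the center. -/
def Subgroup.centralIsolator (p : ℕ) (d : G) : Subgroup G where
  carrier := {x | x ∈ Subgroup.center G ∧ ∃ q : ℕ, q.Coprime p ∧ x ^ q ∈ Subgroup.zpowers d}
  one_mem' := ⟨one_mem _, 1, by simp, by simp⟩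
  mul_mem' := by
    rintro x y ⟨hx, q, hq, hxq⟩ ⟨hy, r, hr, hyr⟩
    refine ⟨mul_mem hx hy, q * r, hq.mul_left hr, ?_⟩
    rw [Commute.mul_pow (Subgroup.mem_center_iff.1 hy x), pow_mul, mul_comm q, pow_mul]
    exact mul_mem (pow_mem hxq _) (pow_mem hyr _)
  inv_mem' := by
    rintro x ⟨hx, q, hq, hxq⟩
    exact ⟨inv_mem hx, q, hq, by rw [inv_pow]; exact inv_mem hxq⟩

instance Subgroup.centralIsolator_normal (d : G) : (Subgroup.centralIsolator p d).Normal :=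
  ⟨fun x hx g => by
    rwa [(Subgroup.mem_center_iff.1 hx.1 g), mul_inv_cancel_right]⟩

theorem Subgroup.centralIsolator_isolated [Group.IsNilpotent G] (hp : p.Prime)
    (hG : IsPPrimeIsolated p (⊥ : Subgroup G)) (d : G) :
    IsPPrimeIsolated p (Subgroup.centralIsolator p d) := by
  rintro x q hq hqp ⟨hx, r, hr, hxr⟩
  exact ⟨hG.center x q hq hqp hx, q * r, ((Nat.coprime_primes hq hp).2 hqp).mul_left hr,
    by rwa [pow_mul]⟩

theorem IsPPrimeIsolated.isPOpen_of_finite {N : Subgroup G} [N.Normal] (hN : IsPPrimeIsolated p N)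
    (hfin : Finite (G ⧸ N)) : N.IsPOpen p := by
  refine ⟨inferInstance, (Nat.card (G ⧸ N)).primeFactorsList.length, ?_⟩
  refine Nat.eq_prime_pow_of_unique_prime_dvd Nat.card_pos.ne' fun {d} hd hdvd => ?_
  by_contra hdp
  have := Fact.mk hd
  obtain ⟨x, hx⟩ := exists_prime_orderOf_dvd_card' d hdvd
  have := hN.isolated_bot_quotient x d hd hdp (by rw [← hx, pow_orderOf_eq_one]; exact one_mem _)
  rw [Subgroup.mem_bot] at this
  rw [this, orderOf_one] at hx
  exact hd.one_lt.ne hx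

/-- A normal `p'`-isolated subgroup `N` maximal among those avoiding a set `S` either has `p`-power
index or has the following property: modulo `N`, there is a central element `z` of infinite order
such that the isolator of each `⟨z ^ p ^ e⟩` meets `S`. -/
theorem Group.exists_isolated_avoiding [Group.FG G] [Group.IsNilpotent G] (hp : p.Prime)
    (hG : IsPPrimeIsolated p (⊥ : Subgroup G)) {S : Set G} (hS : (1 : G) ∉ S) :
    ∃ (N : Subgroup G) (_ : N.Normal), IsPPrimeIsolated p N ∧ (∀ s ∈ S, s ∉ N) ∧
      (N.IsPOpen p ∨ ∃ z ∈ Subgroup.center (G ⧸ N), ¬ IsOfFinOrder z ∧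
        ∀ e : ℕ, ∃ s ∈ S, ∃ q : ℕ, q.Coprime p ∧ ∃ j : ℤ, (s : G ⧸ N) ^ q = z ^ (p ^ e * j)) := by
  let C : Set (Subgroup G) := {N | N.Normal ∧ IsPPrimeIsolated p N ∧ ∀ s ∈ S, s ∉ N}
  obtain ⟨N, -, hN⟩ : ∃ N, ⊥ ≤ N ∧ Maximal (· ∈ C) N := by
    refine zorn_le_nonempty₀ C (fun c hcC hc y hy => ⟨sSup c, ⟨?_, ?_, ?_⟩, fun z => le_sSup⟩) ⊥
      ⟨inferInstance, hG, fun s hs h => hS (by rwa [← Subgroup.mem_bot.1 h])⟩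
    · have hmem : ∀ x, x ∈ sSup c ↔ ∃ M ∈ c, x ∈ M := fun x =>
        Subgroup.mem_sSup_of_directedOn ⟨y, hy⟩ hc.directedOn
      refine ⟨fun x hx g => ?_⟩
      obtain ⟨M, hM, hxM⟩ := (hmem _).1 hx
      exact (hmem _).2 ⟨M, hM, (hcC hM).1.conj_mem x hxM g⟩
    · have hmem : ∀ x, x ∈ sSup c ↔ ∃ M ∈ c, x ∈ M := fun x =>
        Subgroup.mem_sSup_of_directedOn ⟨y, hy⟩ hc.directedOn
      intro x q hq hqp hx
      obtain ⟨M, hM, hxM⟩ := (hmem _).1 hx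
      exact (hmem _).2 ⟨M, hM, (hcC hM).2.1 x q hq hqp hxM⟩
    · intro s hs h
      obtain ⟨M, hM, hxM⟩ := (Subgroup.mem_sSup_of_directedOn ⟨y, hy⟩ hc.directedOn).1 h
      exact (hcC hM).2.2 s hs hxM
  obtain ⟨⟨hNn, hNi, hNS⟩, hmax⟩ := hN
  refine ⟨N, hNn, hNi, hNS, ?_⟩
  by_cases hfin : Finite (G ⧸ N)
  · exact .inl (hNi.isPOpen_of_finite hfin)
  have : Infinite (G ⧸ N) := not_finite_iff_infinite.1 hfin
  obtain ⟨z, hz, hzo⟩ := Group.exists_mem_center_not_isOfFinOrder (G := G ⧸ N)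
  refine .inr ⟨z, hz, hzo, fun e => ?_⟩
  by_contra! hcon
  let I := (Subgroup.centralIsolator p (z ^ p ^ e)).comap (QuotientGroup.mk' N)
  have hI : I ∈ C := by
    refine ⟨inferInstance, (Subgroup.centralIsolator_isolated hp hNi.isolated_bot_quotient _).comap _,
      ?_⟩
    rintro s hs ⟨-, q, hq, j, hj⟩
    refine hcon s hs q hq j ?_
    rw [zpow_mul, ← Nat.cast_pow, zpow_natCast]
    exact hj.symm
  have hle : N ≤ I := fun x hx => by
    rw [Subgroup.mem_comap, QuotientGroup.mk'_apply, (QuotientGroup.eq_one_iff x).2 hx]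
    exact one_mem _
  obtain ⟨w, hw⟩ := QuotientGroup.mk_surjective (z ^ p ^ e)
  have hwI : w ∈ I := by
    rw [Subgroup.mem_comap, QuotientGroup.mk'_apply, hw]
    exact ⟨pow_mem hz _, 1, by simp, by simp⟩
  have := hmax hI hle hwI
  rw [← QuotientGroup.eq_one_iff, hw] at this
  exact hzo (isOfFinOrder_iff_pow_eq_one.2 ⟨p ^ e, pow_pos hp.pos e, this⟩)

theorem Nat.Prime.exists_not_pow_dvd (hp : p.Prime) {j : ℤ} (hj : j ≠ 0) :
    ∃ e : ℕ, ¬ (p : ℤ) ^ e ∣ j := by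
  refine ⟨j.natAbs, fun h => ?_⟩
  have := Int.natAbs_dvd_natAbs.2 h
  rw [Int.natAbs_pow, Int.natAbs_natCast] at this
  exact (Nat.le_of_dvd (Int.natAbs_pos.2 hj) this).not_gt (Nat.lt_pow_self hp.one_lt)

/-- Gruenberg's theorem for a single prime: a finitely generated nilpotent group without elements
of prime order `q ≠ p` is residually `p`-finite. -/
theorem Group.isPResidual_of_isolated_bot [Group.FG G] [Group.IsNilpotent G] (hp : p.Prime)
    (hG : IsPPrimeIsolated p (⊥ : Subgroup G)) : IsPResidual p G := by
  intro x hx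
  obtain ⟨N, _, hNi, hNS, hN | ⟨z, hz, hzo, h⟩⟩ :=
    Group.exists_isolated_avoiding hp hG (S := {x}) (fun h => hx h.symm)
  · exact ⟨N, hN, hNS x rfl⟩
  exfalso
  have hinj : ∀ i j : ℤ, z ^ i = z ^ j → i = j := fun i j =>
    fun h => injective_zpow_iff_not_isOfFinOrder.2 hzo h
  have h' : ∀ e : ℕ, ∃ q : ℕ, q.Coprime p ∧ ∃ j : ℤ, (x : G ⧸ N) ^ q = z ^ (p ^ e * j) := fun e => by
    obtain ⟨s, hs, h⟩ := h e
    rwa [Set.mem_singleton_iff.1 hs] at h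
  obtain ⟨q₀, hq₀, j₀, h₀⟩ := h' 0
  rw [pow_zero, one_mul] at h₀
  have hj₀ : j₀ ≠ 0 := by
    rintro rfl
    rw [zpow_zero, ← QuotientGroup.mk_pow, QuotientGroup.eq_one_iff] at h₀
    exact hNS x rfl (hNi.mem_of_pow_mem hq₀ hp.ne_one h₀)
  obtain ⟨e, he⟩ := hp.exists_not_pow_dvd hj₀
  obtain ⟨q, hq, j, h₁⟩ := h' e
  have h2 : z ^ (j₀ * q) = z ^ (p ^ e * j * q₀) := by
    rw [zpow_mul, zpow_mul _ _ (q₀ : ℤ), ← h₀, ← h₁, zpow_natCast, zpow_natCast, ← pow_mul,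
      ← pow_mul, mul_comm]
  refine he (IsCoprime.dvd_of_dvd_mul_right
    (show IsCoprime ((p : ℤ) ^ e) q from (Nat.isCoprime_iff_coprime.2 hq.symm).pow_left) ⟨j * q₀, ?_⟩)
  · rw [hinj _ _ h2, mul_assoc]

/-- In a finitely generated nilpotent group without elements of prime order `q ≠ p`, an element
none of whose powers prime to `p` lies in `⟨f⟩` is separated from `⟨f⟩`. -/
theorem Group.pSeparates_of_isNilpotent [Group.FG G] [Group.IsNilpotent G] (hp : p.Prime)
    (hG : IsPPrimeIsolated p (⊥ : Subgroup G)) {f g : G}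
    (hg : ∀ q : ℕ, q.Coprime p → g ^ q ∉ Subgroup.zpowers f) : PSeparates p f g := by
  by_cases hc : Commute f g
  swap
  · exact .of_not_commute (Group.isPResidual_of_isolated_bot hp hG) hc
  let S : Set G := {s | ∃ (q : ℕ) (i : ℤ), q.Coprime p ∧ s = g ^ q * f ^ i}
  have hS : (1 : G) ∉ S := by
    rintro ⟨q, i, hq, h⟩
    exact hg q hq ⟨-i, by simpa using (eq_inv_of_mul_eq_one_left h.symm).symm⟩
  obtain ⟨N, _, hNi, hNS, hN | ⟨z, hz, hzo, h⟩⟩ := Group.exists_isolated_avoiding hp hG hS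
  · exact ⟨N, hN, fun i => hNS _ ⟨1, i, by simp, by simp⟩⟩
  have hNG := hNi.isolated_bot_quotient
  have hcN : Commute (f : G ⧸ N) (g : G ⧸ N) := hc.map (QuotientGroup.mk' N)
  -- Replacing elements of `S` by powers, one may take `z ^ (p ^ e * j)` itself in the image of `S`.
  have h' : ∀ e : ℕ, ∃ (q : ℕ) (i j : ℤ), q.Coprime p ∧
      (g : G ⧸ N) ^ q * (f : G ⧸ N) ^ i = z ^ (p ^ e * j) := fun e => by
    obtain ⟨_, ⟨r, i, hr, rfl⟩, q, hq, j, hj⟩ := h e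
    refine ⟨r * q, i * q, j, hr.mul_left hq, ?_⟩
    rw [← hj, QuotientGroup.mk_mul, QuotientGroup.mk_pow, QuotientGroup.mk_zpow,
      ((hcN.symm.pow_left r).zpow_right i).mul_pow, pow_mul, zpow_mul, zpow_natCast]
  obtain ⟨q₀, i₀, j₀, hq₀, h₀⟩ := h' 0
  rw [pow_zero, one_mul] at h₀
  have hj₀ : j₀ ≠ 0 := by
    rintro rfl
    rw [zpow_zero, ← QuotientGroup.mk_pow, ← QuotientGroup.mk_zpow, ← QuotientGroup.mk_mul,
      QuotientGroup.eq_one_iff] at h₀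
    exact hNS _ ⟨q₀, i₀, hq₀, rfl⟩ h₀
  obtain ⟨e, he⟩ := hp.exists_not_pow_dvd hj₀
  obtain ⟨q, i, j, hq, h₁⟩ := h' e
  set y : ℤ := j₀ * q - p ^ e * j * q₀ with hy
  have hy0 : y ≠ 0 := fun hy0 => by
    refine he (IsCoprime.dvd_of_dvd_mul_right
      (show IsCoprime ((p : ℤ) ^ e) q from (Nat.isCoprime_iff_coprime.2 hq.symm).pow_left)
      ⟨j * q₀, ?_⟩)
    · linear_combination hy0 - hy
  -- Eliminating `g` between the two relations puts a power of `z` into `⟨f⟩`.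
  have hzy : z ^ y ∈ Subgroup.zpowers (f : G ⧸ N) := by
    have ha : z ^ (j₀ * q) = (g : G ⧸ N) ^ (q₀ * q) * (f : G ⧸ N) ^ (i₀ * q) := by
      rw [zpow_mul, ← h₀, zpow_natCast, ((hcN.symm.pow_left q₀).zpow_right i₀).mul_pow, pow_mul,
        zpow_mul, zpow_natCast]
    have hb : z ^ (p ^ e * j * q₀) = (g : G ⧸ N) ^ (q₀ * q) * (f : G ⧸ N) ^ (i * q₀) := by
      rw [zpow_mul, ← h₁, zpow_natCast, ((hcN.symm.pow_left q).zpow_right i).mul_pow, mul_comm q₀,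
        pow_mul, zpow_mul, zpow_natCast]
    refine ⟨i₀ * q - i * q₀, ?_⟩
    simp only [hy]
    rw [zpow_sub z, ha, hb, mul_inv_rev, zpow_sub, mul_assoc, ← mul_assoc _ _ ((_ : G ⧸ N) ^ (_ : ℕ))⁻¹,
      ← mul_assoc]
    rw [((((hcN.symm.pow_left (q₀ * q)).zpow_right (i₀ * q)).mul_right
      ((hcN.symm.pow_left (q₀ * q)).zpow_right (i * q₀)).inv_right)).eq, mul_inv_cancel_right]
  refine PSeparates.comap hp (QuotientGroup.mk' N) (.of_pow_mem hp
    (Group.isPResidual_of_isolated_bot hp hNG) hcN (y := q₀ * y) ?_ ?_ ?_)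
  · refine mul_ne_zero ?_ hy0
    rintro h
    rw [Nat.cast_eq_zero] at h
    rw [h, Nat.coprime_zero_left] at hq₀
    exact hp.ne_one hq₀
  · rw [zpow_mul, zpow_natCast]
    have : (QuotientGroup.mk' N g) ^ q₀ = z ^ j₀ * (QuotientGroup.mk' N f) ^ (-i₀) := by
      rw [← h₀, zpow_neg, QuotientGroup.mk'_apply, QuotientGroup.mk'_apply, mul_inv_cancel_right]
    have hzc : Commute (z ^ j₀) ((QuotientGroup.mk' N f) ^ (-i₀)) :=
      ((show Commute z (QuotientGroup.mk' N f) from (Subgroup.mem_center_iff.1 hz _).symm).zpow_zpow _ _)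
    rw [this, hzc.mul_zpow, ← zpow_mul, mul_comm j₀, zpow_mul]
    exact mul_mem (zpow_mem hzy _) (zpow_mem (zpow_mem (Subgroup.mem_zpowers _) _) _)
  · rintro r hr ⟨k, hk⟩
    refine hNS _ ⟨r, -k, hr, rfl⟩ ?_
    rw [← QuotientGroup.eq_one_iff, QuotientGroup.mk_mul, QuotientGroup.mk_pow,
      QuotientGroup.mk_zpow, zpow_neg, mul_inv_eq_one]
    exact hk.symm

end Isolated

/-! ### Prescribed orders in finite `p`-quotients, and maximal cyclic subgroups -/

section Orders

variable {p : ℕ} {G : Type*} [Group G]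

theorem Nat.Prime.exists_eq_pow_mul_int (hp : p.Prime) {x : ℤ} (hx : x ≠ 0) :
    ∃ (a : ℕ) (u : ℤ), IsCoprime u p ∧ x = p ^ a * u := by
  obtain ⟨a, q, hq, haq⟩ :=
    Nat.exists_eq_pow_mul_and_not_dvd (Int.natAbs_ne_zero.2 hx) p hp.ne_one
  have hu : IsCoprime (q : ℤ) p :=
    Nat.isCoprime_iff_coprime.2 ((hp.coprime_iff_not_dvd).2 hq).symm
  rcases Int.natAbs_eq x with h | h
  · exact ⟨a, q, hu, by rw [h, haq]; push_cast; ring⟩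
  · exact ⟨a, -q, hu.neg_left, by rw [h, haq]; push_cast; ring⟩

/-- The order of `c` modulo an open subgroup is detected by powers `c ^ p ^ e`. -/
theorem Subgroup.IsPOpen.zpow_mem_iff (hp : p.Prime) {N : Subgroup G} (hN : N.IsPOpen p) {c : G}
    {e : ℕ} (h1 : c ^ p ^ e ∈ N) (h2 : ∀ b < e, c ^ p ^ b ∉ N) (x : ℤ) :
    c ^ x ∈ N ↔ (p : ℤ) ^ e ∣ x := by
  constructor
  · intro hx
    rcases eq_or_ne x 0 with rfl | hx0
    · exact dvd_zero _
    obtain ⟨a, u, hu, rfl⟩ := hp.exists_eq_pow_mul_int hx0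
    rw [zpow_mul] at hx
    have := hN.mem_of_zpow_mem hu hx
    rw [← Nat.cast_pow, zpow_natCast] at this
    exact (pow_dvd_pow _ (not_lt.1 fun h => h2 a h this)).mul_right u
  · rintro ⟨k, rfl⟩
    rw [zpow_mul, ← Nat.cast_pow, zpow_natCast]
    exact zpow_mem h1 k

/-- In a finitely generated nilpotent group without `p'`-torsion, an element `c` of infinite order
attains every sufficiently large `p`-power order in arbitrarily fine finite `p`-quotients. The
point is that modulo a suitable normal subgroup some power of `c` is central of infinite order, so
that the isolators of its powers can be factored out. -/
theorem Group.exists_isPOpen_zpow_mem_iff [Group.FG G] [Group.IsNilpotent G] (hp : p.Prime)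
    (hG : IsPPrimeIsolated p (⊥ : Subgroup G)) {c : G} (hc : ¬ IsOfFinOrder c) {M : Subgroup G}
    (hM : M.IsPOpen p) :
    ∃ e₀ : ℕ, ∀ e ≥ e₀, ∃ N : Subgroup G, N.IsPOpen p ∧ N ≤ M ∧
      ∀ x : ℤ, c ^ x ∈ N ↔ (p : ℤ) ^ e ∣ x := by
  have hone : (1 : G) ∉ {s | ∃ k : ℤ, k ≠ 0 ∧ s = c ^ k} := fun ⟨k, hk, h⟩ =>
    hc (isOfFinOrder_iff_zpow_eq_one.2 ⟨k, hk, h.symm⟩)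
  obtain ⟨N, _, hNi, hNS, h⟩ := Group.exists_isolated_avoiding hp hG hone
  have hcN : ∀ k : ℤ, (c : G ⧸ N) ^ k = 1 → k = 0 := fun k hk => by
    by_contra hk0
    rw [← QuotientGroup.mk_zpow, QuotientGroup.eq_one_iff] at hk
    exact hNS _ ⟨k, hk0, rfl⟩ hk
  have hNG := hNi.isolated_bot_quotient
  -- Some nonzero power `c ^ K` is central modulo `N`.
  obtain ⟨K, hK0, hK⟩ : ∃ K : ℤ, K ≠ 0 ∧ (c : G ⧸ N) ^ K ∈ Subgroup.center (G ⧸ N) := by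
    rcases h with h | ⟨z, hz, -, h⟩
    · obtain ⟨k, hk⟩ := h.pow_mem
      have := hcN (p ^ k : ℕ) (by
        rw [zpow_natCast, ← QuotientGroup.mk_pow, QuotientGroup.eq_one_iff]; exact hk c)
      exact absurd this (by exact_mod_cast (pow_pos hp.pos k).ne')
    · obtain ⟨_, ⟨k, hk, rfl⟩, q, hq, j, hj⟩ := h 0
      refine ⟨k * q, mul_ne_zero hk ?_, ?_⟩
      · rintro h
        rw [Nat.cast_eq_zero] at h
        rw [h, Nat.coprime_zero_left] at hq
        exact hp.ne_one hq
      · rw [zpow_mul, zpow_natCast, ← QuotientGroup.mk_zpow, hj]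
        exact zpow_mem hz _
  obtain ⟨a, u, hu, rfl⟩ := hp.exists_eq_pow_mul_int hK0
  have hu0 : u ≠ 0 := right_ne_zero_of_mul hK0
  obtain ⟨k₀, hk₀⟩ := hM.pow_mem
  refine ⟨max a k₀, fun e he => ?_⟩
  obtain ⟨e', rfl⟩ : ∃ e', e = e' + a := ⟨e - a, by omega⟩
  set I := Subgroup.centralIsolator p (((c : G ⧸ N) ^ ((p : ℤ) ^ a * u)) ^ p ^ e') with hI
  have hmemI : ∀ b : ℕ, b < e' + a → (c : G ⧸ N) ^ p ^ b ∉ I := by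
    rintro b hb ⟨-, q, hq, t, ht⟩
    have h0 := hcN (p ^ b * q - p ^ (e' + a) * (u * t)) (by
      rw [zpow_sub, mul_inv_eq_one, zpow_mul, zpow_natCast, ← Nat.cast_pow, zpow_natCast, ← ht]
      simp only []
      rw [← zpow_natCast, ← zpow_mul, ← zpow_mul]
      congr 1
      push_cast
      ring)
    have h1 : (p : ℤ) ^ (b + 1) ∣ p ^ b * q :=
      (pow_dvd_pow _ hb).trans ⟨u * t, by linear_combination h0⟩
    rw [pow_succ] at h1
    have hp0 : (p : ℤ) ≠ 0 := by exact_mod_cast hp.ne_zero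
    have h2 := Int.natCast_dvd_natCast.1 ((mul_dvd_mul_iff_left (pow_ne_zero b hp0)).1 h1)
    exact hp.not_dvd_one (hq ▸ Nat.dvd_gcd h2 dvd_rfl)
  have hmemI' : (c : G ⧸ N) ^ p ^ (e' + a) ∈ I := by
    have hcen := (hNG.center).mem_of_pow_mem (q := u.natAbs) (g := (c : G ⧸ N) ^ p ^ a)
      (by simpa [Int.isCoprime_iff_gcd_eq_one, Int.gcd, Nat.Coprime] using hu) hp.ne_one (by
        rw [← zpow_natCast _ u.natAbs, ← zpow_natCast, ← zpow_mul]
        push_cast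
        rcases abs_choice u with h | h <;> rw [h]
        · exact hK
        · rw [mul_neg, zpow_neg]; exact inv_mem hK)
    refine ⟨?_, u.natAbs, by simpa [Int.isCoprime_iff_gcd_eq_one, Int.gcd, Nat.Coprime] using hu, ?_⟩
    · rw [pow_add, mul_comm, pow_mul]
      exact pow_mem hcen _
    · have h : ((c : G ⧸ N) ^ p ^ (e' + a)) ^ u =
          ((c : G ⧸ N) ^ ((p : ℤ) ^ a * u)) ^ p ^ e' := by
        rw [← zpow_natCast, ← zpow_natCast, ← zpow_mul, ← zpow_mul]
        congr 1
        push_cast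
        ring
      rw [← zpow_natCast _ u.natAbs, Int.natCast_natAbs, ← h]
      rcases abs_choice u with h' | h' <;> rw [h']
      · exact Subgroup.mem_zpowers _
      · rw [zpow_neg]; exact inv_mem (Subgroup.mem_zpowers _)
  have hRG : IsPPrimeIsolated p (⊥ : Subgroup ((G ⧸ N) ⧸ I)) :=
    (Subgroup.centralIsolator_isolated hp hNG _).isolated_bot_quotient
  have hR := Group.isPResidual_of_isolated_bot hp hRG
  let π : G →* (G ⧸ N) ⧸ I := (QuotientGroup.mk' I).comp (QuotientGroup.mk' N)
  have hπ : ∀ b : ℕ, π (c ^ p ^ b) = 1 ↔ (c : G ⧸ N) ^ p ^ b ∈ I := fun b => by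
    rw [MonoidHom.comp_apply, QuotientGroup.mk'_apply, QuotientGroup.eq_one_iff, map_pow]; rfl
  obtain ⟨N', hN', hcN'⟩ := hR.exists_inter hp
    (s := (fun b : ℕ => π (c ^ p ^ b)) '' {b | b < e' + a}) ((Set.finite_lt_nat _).image _) (by
      rintro ⟨b, hb, h⟩
      exact hmemI b hb ((hπ b).1 h))
  have hN'' := hN'.comap hp π
  refine ⟨M ⊓ N'.comap π, hM.inf hp hN'', inf_le_left, (hM.inf hp hN'').zpow_mem_iff hp ⟨?_, ?_⟩ ?_⟩
  · obtain ⟨d, hd⟩ : ∃ d, e' + a = k₀ + d := ⟨e' + a - k₀, by omega⟩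
    rw [hd, pow_add, pow_mul]
    exact pow_mem (hk₀ c) _
  · change π _ ∈ N'
    rw [(hπ _).2 hmemI']
    exact one_mem _
  · exact fun b hb h => hcN' _ ⟨b, hb, rfl⟩ h.2

end Orders

section MaximalCyclic

variable {p : ℕ} {G : Type*} [Group G]

theorem IsMaximalInfiniteCyclic.not_isOfFinOrder {h : G}
    (hh : IsMaximalInfiniteCyclic (Subgroup.zpowers h)) : ¬ IsOfFinOrder h := fun hf => by
  have h1 : Infinite (Subgroup.zpowers h) := hh.prop.2
  have h2 : (Subgroup.zpowers h : Set G).Finite := by simpa using hf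
  exact h1.not_finite h2.to_subtype

/-- A maximal infinite cyclic subgroup is `p'`-isolated: elements with a common nontrivial power
prime to `p` commute, so a `q`-th root of an element of `⟨h⟩` yields a `q`-th root of `h`. -/
theorem IsMaximalInfiniteCyclic.isPPrimeIsolated (hp : p.Prime) (hG : IsPResidual p G) {h : G}
    (hh : IsMaximalInfiniteCyclic (Subgroup.zpowers h)) :
    IsPPrimeIsolated p (Subgroup.zpowers h) := by
  rintro g q hq hqp ⟨j, hj : h ^ j = g ^ q⟩
  have hqp' : IsCoprime (q : ℤ) p := Nat.isCoprime_iff_coprime.2 ((Nat.coprime_primes hq hp).2 hqp)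
  have hc : Commute g h := by
    by_contra hc
    obtain ⟨N, hN, hcN⟩ := hG (g * h * g⁻¹ * h⁻¹) (fun h' => hc (by
      rw [mul_inv_eq_one, mul_inv_eq_iff_eq_mul] at h'
      exact h'))
    have := hN.normal
    obtain ⟨k, hk⟩ := hN.pow_mem
    obtain ⟨u, v, huv⟩ := hqp'.pow_right (n := k)
    have hg : (g : G ⧸ N) = (h : G ⧸ N) ^ (j * u) := by
      have h1 : (g : G ⧸ N) ^ ((p : ℤ) ^ k) = 1 := by
        rw [← Nat.cast_pow, zpow_natCast, ← QuotientGroup.mk_pow, QuotientGroup.eq_one_iff]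
        exact hk g
      have h2 : (h : G ⧸ N) ^ j = (g : G ⧸ N) ^ (q : ℤ) := by
        rw [zpow_natCast, ← QuotientGroup.mk_pow, ← hj, QuotientGroup.mk_zpow]
      rw [zpow_mul, h2, ← zpow_mul, mul_comm (q : ℤ) u, eq_sub_of_add_eq huv, zpow_sub, zpow_one,
        mul_comm v, zpow_mul, h1, one_zpow, inv_one, mul_one]
    apply hcN
    rw [← QuotientGroup.eq_one_iff, QuotientGroup.mk_mul, QuotientGroup.mk_mul, QuotientGroup.mk_mul,
      QuotientGroup.mk_inv, QuotientGroup.mk_inv, hg, ((Commute.refl (h : G ⧸ N)).zpow_left _).eq,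
      mul_inv_cancel_right, mul_inv_cancel]
  have hcz : ∀ a b : ℤ, Commute (g ^ a) (h ^ b) := fun a b => hc.zpow_zpow a b
  by_cases hqj : (q : ℤ) ∣ j
  · obtain ⟨i, rfl⟩ := hqj
    have : (g * h ^ (-i)) ^ (q : ℤ) = 1 := by
      rw [((hc.zpow_right (-i))).mul_zpow, zpow_natCast g, ← hj, ← zpow_mul, ← zpow_add]
      rw [show (q : ℤ) * i + -i * q = 0 by ring, zpow_zero]
    have := hG.eq_one_of_zpow_eq_one hqp' this
    exact ⟨i, by simpa using (eq_inv_of_mul_eq_one_left this).symm⟩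
  · obtain ⟨u, v, huv⟩ : IsCoprime j q :=
      ((Nat.prime_iff_prime_int.1 hq).coprime_iff_not_dvd.2 hqj).symm
    set y := g ^ u * h ^ v with hy
    have hyq : y ^ (q : ℤ) = h := by
      rw [hy, (hcz u v).mul_zpow, ← zpow_mul, mul_comm u, zpow_mul, zpow_natCast g, ← hj, ← zpow_mul,
        ← zpow_mul, ← zpow_add, mul_comm j, huv, zpow_one]
    have hle : Subgroup.zpowers h ≤ Subgroup.zpowers y := by
      rw [Subgroup.zpowers_le]; exact ⟨q, hyq⟩
    have hinf : Infinite (Subgroup.zpowers y) := by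
      have := hh.prop.2
      exact Infinite.of_injective _ (Subgroup.inclusion_injective hle)
    obtain ⟨i, hi : h ^ i = y⟩ := hh.le_of_ge ⟨inferInstance, hinf⟩ hle (Subgroup.mem_zpowers y)
    exfalso
    have h1 : h ^ (i * q) = h ^ (1 : ℤ) := by rw [zpow_mul, hi, hyq, zpow_one]
    have h2 := injective_zpow_iff_not_isOfFinOrder.2 hh.not_isOfFinOrder h1
    have h3 : (q : ℤ) ∣ 1 := ⟨i, by linarith [mul_comm i (q : ℤ)]⟩
    exact hq.not_dvd_one (by exact_mod_cast h3)

theorem IsMaximalInfiniteCyclic.isPPrimeIsolated_zpowers_pow (hp : p.Prime) (hG : IsPResidual p G)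
    {h : G} (hh : IsMaximalInfiniteCyclic (Subgroup.zpowers h)) (s : ℕ) :
    IsPPrimeIsolated p (Subgroup.zpowers (h ^ p ^ s)) := by
  rintro g q hq hqp ⟨j, hj : (h ^ p ^ s) ^ j = g ^ q⟩
  have hj' : h ^ (((p ^ s : ℕ) : ℤ) * j) = g ^ q := by rw [zpow_mul, zpow_natCast, hj]
  obtain ⟨i, rfl⟩ := hh.isPPrimeIsolated hp hG g q hq hqp ⟨_, hj'⟩
  simp only [← zpow_natCast (h ^ i), ← zpow_mul] at hj'
  have h2 := injective_zpow_iff_not_isOfFinOrder.2 hh.not_isOfFinOrder hj'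
  have hcop : IsCoprime (((p ^ s : ℕ) : ℤ)) (q : ℤ) :=
    Nat.isCoprime_iff_coprime.2 (((Nat.coprime_primes hp hq).2 (Ne.symm hqp)).pow_left s)
  obtain ⟨l, rfl⟩ := hcop.dvd_of_dvd_mul_right ⟨j, h2.symm⟩
  exact ⟨l, by simp only [zpow_mul, zpow_natCast]⟩

end MaximalCyclic

/-! ### Amalgams of finite `p`-groups along a cyclic subgroup -/

section Wreath

theorem isPGroup_regularWreathProduct {p : ℕ} (hp : p.Prime) {D Q : Type*} [Group D] [Group Q]
    [Finite D] [Finite Q] (hD : IsPGroup p D) (hQ : IsPGroup p Q) : IsPGroup p (D ≀ᵣ Q) := by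
  have : Fact p.Prime := ⟨hp⟩
  obtain ⟨a, ha⟩ := IsPGroup.iff_card.1 hD
  obtain ⟨b, hb⟩ := IsPGroup.iff_card.1 hQ
  refine IsPGroup.of_card (n := a * Nat.card Q + b) ?_
  rw [RegularWreathProduct.card, ha, ← pow_mul, pow_add, ← hb]

/-- A transversal for the cosets `S x`: the representative of `S x` is `(r x)⁻¹`. -/
theorem Subgroup.exists_right_transversal {P : Type*} [Group P] (S : Subgroup P) :
    ∃ r : P → P, (∀ x, x * r x ∈ S) ∧ ∀ s ∈ S, ∀ x, r (s * x) = r x := by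
  refine ⟨fun x => ((x⁻¹ : P) : P ⧸ S).out, fun x => ?_, fun s hs x => ?_⟩
  · have h : (((x⁻¹ : P) : P ⧸ S).out : P ⧸ S) = (x⁻¹ : P) := QuotientGroup.out_eq' _
    have := QuotientGroup.eq.1 h.symm
    rwa [inv_inv] at this
  · have h : (((s * x)⁻¹ : P) : P ⧸ S) = (x⁻¹ : P) := by
      rw [QuotientGroup.eq]
      simpa using hs
    simp only [h]

/-- A function on a group whose products over the orbits of left multiplication by `s` are trivial
is a coboundary for that action. -/
theorem exists_eq_mul_of_prod_orbit_eq_one {P U : Type*} [Group P] [CommGroup U] {s : P}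
    (hs : IsOfFinOrder s) (D : P → U)
    (hD : ∀ x, ∏ i ∈ Finset.range (orderOf s), D (s ^ i * x) = 1) :
    ∃ ε : P → U, ∀ x, ε (s * x) = ε x * D x := by
  obtain ⟨r, hr, hr'⟩ := (Subgroup.zpowers s).exists_right_transversal
  have hpow : ∀ x, ∃ n : ℕ, s ^ n = x * r x := fun x =>
    (hs.mem_powers_iff_mem_zpowers).2 (hr x)
  choose n hn using hpow
  let F : P → ℕ → U := fun y k => ∏ i ∈ Finset.range k, D (s ^ i * y)
  have hper : ∀ y, Function.Periodic (F y) (orderOf s) := fun y k => by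
    simp only [F, Finset.prod_range_add]
    rw [mul_eq_left]
    convert hD (s ^ k * y) using 2 with i
    rw [add_comm, pow_add, mul_assoc]
  have hF : ∀ y k l, s ^ k = s ^ l → F y k = F y l := fun y k l h => by
    rw [← (hper y).map_mod_nat k, ← (hper y).map_mod_nat l, pow_eq_pow_iff_modEq.1 h]
  refine ⟨fun x => F (r x)⁻¹ (n x), fun x => ?_⟩
  have hrs := hr' s (Subgroup.mem_zpowers s) x
  have h1 : F (r x)⁻¹ (n (s * x)) = F (r x)⁻¹ (n x + 1) := hF _ _ _ (by
    rw [hn, hrs, pow_succ', hn, mul_assoc])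
  simp only [hrs]
  rw [h1]
  simp only [F, Finset.prod_range_succ]
  rw [hn, mul_inv_cancel_right]

theorem RegularWreathProduct.pow_left {D Q : Type*} [CommGroup D] [Group Q] (w : D ≀ᵣ Q) (n : ℕ) :
    (w ^ n).left = fun x => ∏ i ∈ Finset.range n, w.left (w.right⁻¹ ^ i * x) := by
  have hright : ∀ n : ℕ, (w ^ n).right = w.right ^ n := fun n =>
    map_pow (RegularWreathProduct.rightHom : D ≀ᵣ Q →* Q) w n
  induction n with
  | zero => rfl
  | succ n ih =>
    ext x
    rw [pow_succ, RegularWreathProduct.mul_left, Pi.mul_apply, ih, hright, Finset.prod_range_succ,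
      inv_pow]

/-- Two elements of a wreath product `U ≀ P`, `U` commutative, are conjugate by an element of the
base group if they have the same image `c` in `P` and the same power of exponent `orderOf c`. -/
theorem RegularWreathProduct.exists_conj_eq {U P : Type*} [CommGroup U] [Group P] {v w : U ≀ᵣ P}
    (hfin : IsOfFinOrder v.right) (hright : v.right = w.right)
    (hpow : v ^ orderOf v.right = w ^ orderOf v.right) : ∃ y : U ≀ᵣ P, y * v * y⁻¹ = w := by
  obtain ⟨ε, hε⟩ := exists_eq_mul_of_prod_orbit_eq_one (s := v.right⁻¹) hfin.inv
    (fun x => v.left x * (w.left x)⁻¹) (fun x => by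
      have h1 := congrFun (RegularWreathProduct.pow_left v (orderOf v.right)) x
      have h2 := congrFun (RegularWreathProduct.pow_left w (orderOf v.right)) x
      rw [orderOf_inv, Finset.prod_mul_distrib, Finset.prod_inv_distrib, ← h1, hpow, h2, hright,
        mul_inv_cancel])
  refine ⟨⟨ε, 1⟩, ?_⟩
  ext x
  · simp only [mul_left, inv_left, mul_right, Pi.mul_apply, Pi.inv_apply, inv_one, one_mul]
    rw [hε x]
    rw [mul_inv_rev, mul_inv_rev, inv_inv, mul_comm (ε x) (v.left x)]
    simp [mul_comm, mul_left_comm]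
  · simp [hright]

/-- The Krasner–Kaloujnine embedding of an extension by a central subgroup `⟨z⟩` of order `p`: an
embedding of the quotient into `P` lifts to an embedding into the wreath product of `ℤ/p` and `P`
mapping `z` to a standard constant function. -/
theorem exists_injective_regularWreathProduct {p : ℕ} {A P : Type*} [Group A] [Group P]
    {z : A} (hz : z ∈ Subgroup.center A) (hzp : orderOf z = p) {α : A →* P}
    (hα : α.ker = Subgroup.zpowers z) :
    ∃ ρ : A →* Multiplicative (ZMod p) ≀ᵣ P, Function.Injective ρ ∧ (∀ a, (ρ a).right = α a) ∧
      ρ z = ⟨fun _ => Multiplicative.ofAdd 1, 1⟩ := by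
  have hgen : ∀ x : Subgroup.zpowers z, x ∈ Subgroup.zpowers
      (⟨z, Subgroup.mem_zpowers z⟩ : Subgroup.zpowers z) := by
    rintro ⟨x, k, rfl⟩
    exact ⟨k, Subtype.ext (by simp)⟩
  have hgen' : ∀ x : Multiplicative (ZMod p), x ∈ Subgroup.zpowers (Multiplicative.ofAdd (1 : ZMod p)) := by
    intro x
    obtain ⟨k, hk⟩ := ZMod.intCast_surjective x.toAdd
    refine ⟨k, ?_⟩
    change Multiplicative.ofAdd (1 : ZMod p) ^ k = x
    rw [← ofAdd_zsmul, zsmul_one, hk, ofAdd_toAdd]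
  have hord : orderOf (⟨z, Subgroup.mem_zpowers z⟩ : Subgroup.zpowers z) =
      orderOf (Multiplicative.ofAdd (1 : ZMod p)) := by
    rw [orderOf_ofAdd_eq_addOrderOf, ZMod.addOrderOf_one, Subgroup.orderOf_mk, hzp]
  let l : Subgroup.zpowers z ≃* Multiplicative (ZMod p) := mulEquivOfOrderOfEq hgen hgen' hord
  have hlz : l ⟨z, Subgroup.mem_zpowers z⟩ = Multiplicative.ofAdd 1 := mulEquivOfOrderOfEq_apply_gen ..
  obtain ⟨r, hr, hr'⟩ := α.range.exists_right_transversal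
  choose t ht using hr
  have hker : ∀ a x, (t x)⁻¹ * a * t ((α a)⁻¹ * x) ∈ Subgroup.zpowers z := fun a x => by
    rw [← hα, MonoidHom.mem_ker, map_mul, map_mul, map_inv, ht, ht, ← map_inv,
      hr' _ ⟨a⁻¹, rfl⟩, map_inv]
    group
  let ρ : A →* Multiplicative (ZMod p) ≀ᵣ P := MonoidHom.mk'
    (fun a => ⟨fun x => l ⟨_, hker a x⟩, α a⟩) (fun a b => by
      ext x
      · simp only [RegularWreathProduct.mul_left, Pi.mul_apply, ← map_mul]
        congr 2
        ext
        simp only [Subgroup.coe_mul, map_mul, mul_inv_rev, mul_assoc, mul_inv_cancel_left]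
      · simp)
  have hcen : ∀ x, (t x)⁻¹ * z * t x = z := fun x => by
    rw [mul_assoc, ← Subgroup.mem_center_iff.1 hz, inv_mul_cancel_left]
  have hαz : α z = 1 := by
    rw [← MonoidHom.mem_ker, hα]; exact Subgroup.mem_zpowers z
  refine ⟨ρ, (injective_iff_map_eq_one ρ).2 fun a ha => ?_, fun a => rfl, ?_⟩
  · have h1 : α a = 1 := congrArg RegularWreathProduct.right ha
    have h2 := congrFun (congrArg RegularWreathProduct.left ha) 1
    have h3 : l ⟨_, hker a 1⟩ = 1 := h2
    rw [map_eq_one_iff l l.injective] at h3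
    have h4 : (t 1)⁻¹ * a * t ((α a)⁻¹ * 1) = 1 := congrArg Subtype.val h3
    rw [h1, inv_one, one_mul, mul_eq_one_iff_eq_inv, inv_mul_eq_iff_eq_mul, mul_inv_cancel] at h4
    exact h4
  · refine RegularWreathProduct.ext (funext fun x => ?_) hαz
    change l ⟨_, hker z x⟩ = Multiplicative.ofAdd 1
    rw [← hlz]
    congr 2
    rw [hαz, inv_one, one_mul, hcen]

end Wreath

section Amalgam

variable {p : ℕ}

/-- The groups `A` and `B` embed in a common finite `p`-group in such a way that `a` and `b`
coincide. The images of `A` and `B` may intersect in more than the group generated by `a`. -/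
def EmbedsInFinitePGroup (p : ℕ) {A : Type u} {B : Type v} [Group A] [Group B] (a : A) (b : B) :
    Prop :=
  ∃ (P : Type (max u v)) (_ : Group P) (α : A →* P) (β : B →* P), Finite P ∧ IsPGroup p P ∧
    Function.Injective α ∧ Function.Injective β ∧ α a = β b

theorem EmbedsInFinitePGroup.symm {A : Type u} {B : Type v} [Group A] [Group B] {a : A} {b : B}
    (h : EmbedsInFinitePGroup p a b) : EmbedsInFinitePGroup p b a := by
  obtain ⟨P, _, α, β, h1, h2, h3, h4, h5⟩ := h
  exact ⟨P, _, β, α, h1, h2, h4, h3, h5.symm⟩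

/-- Embeddings of `A` and `B` in a wreath product need not map `a` and `b` to the same element, but
only to elements satisfying the criterion for conjugacy under the base group. -/
theorem EmbedsInFinitePGroup.of_regularWreathProduct (hp : p.Prime) {A : Type u} {B : Type v}
    [Group A] [Group B] {a : A} {b : B} {P : Type (max u v)} [Group P] [Finite P]
    (hP : IsPGroup p P) (ρ : A →* Multiplicative (ZMod p) ≀ᵣ P)
    (σ : B →* Multiplicative (ZMod p) ≀ᵣ P) (hρ : Function.Injective ρ) (hσ : Function.Injective σ)
    (hright : (ρ a).right = (σ b).right)
    (hpow : ρ a ^ orderOf (ρ a).right = σ b ^ orderOf (ρ a).right) :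
    EmbedsInFinitePGroup p a b := by
  have : NeZero p := ⟨hp.ne_zero⟩
  obtain ⟨y, hy⟩ := RegularWreathProduct.exists_conj_eq (isOfFinOrder_of_finite _) hright hpow
  have hZ : IsPGroup p (Multiplicative (ZMod p)) := IsPGroup.of_card (n := 1) (by simp)
  refine ⟨Multiplicative (ZMod p) ≀ᵣ P, inferInstance, (MulAut.conj y).toMonoidHom.comp ρ, σ,
    inferInstance, isPGroup_regularWreathProduct hp hZ hP, ?_, hσ, ?_⟩
  · exact (MulAut.conj y).injective.comp hρ
  · exact hy

theorem orderOf_mk_of_disjoint {A : Type*} [Group A] {N : Subgroup A} [N.Normal] {c : A}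
    (h : ∀ n : ℕ, c ^ n ∈ N → c ^ n = 1) : orderOf (c : A ⧸ N) = orderOf c := by
  refine orderOf_eq_orderOf_iff.2 fun n => ?_
  rw [← QuotientGroup.mk_pow, QuotientGroup.eq_one_iff]
  exact ⟨h n, fun h => h ▸ one_mem _⟩

theorem Subgroup.normal_zpowers_of_mem_center {A : Type*} [Group A] {z : A}
    (hz : z ∈ Subgroup.center A) : (Subgroup.zpowers z).Normal := ⟨fun x hx g => by
  have : x ∈ Subgroup.center A := (Subgroup.zpowers_le.2 hz) hx
  rwa [(Subgroup.mem_center_iff.1 this g), mul_inv_cancel_right]⟩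

theorem orderOf_pow_prime_pow (hp : p.Prime) {A : Type*} [Group A] {c : A} {N : ℕ}
    (hc : orderOf c = p ^ (N + 1)) : orderOf (c ^ p ^ N) = p := by
  rw [orderOf_pow_of_dvd (pow_ne_zero _ hp.ne_zero) (hc ▸ pow_dvd_pow p N.le_succ), hc, pow_succ,
    Nat.mul_div_cancel_left _ (pow_pos hp.pos N)]

theorem orderOf_mk_zpowers_pow (hp : p.Prime) {A : Type*} [Group A] {c : A} {N : ℕ}
    [(Subgroup.zpowers (c ^ p ^ N)).Normal] (hc : orderOf c = p ^ (N + 1)) :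
    orderOf (c : A ⧸ Subgroup.zpowers (c ^ p ^ N)) = p ^ N := by
  refine Nat.dvd_antisymm (orderOf_dvd_of_pow_eq_one ?_) ?_
  · rw [← QuotientGroup.mk_pow, QuotientGroup.eq_one_iff]
    exact Subgroup.mem_zpowers _
  · have h := pow_orderOf_eq_one (c : A ⧸ Subgroup.zpowers (c ^ p ^ N))
    rw [← QuotientGroup.mk_pow, QuotientGroup.eq_one_iff] at h
    obtain ⟨k, hk : (c ^ p ^ N) ^ k = _⟩ := h
    have h1 : c ^ (orderOf (c : A ⧸ Subgroup.zpowers (c ^ p ^ N)) * p) = 1 := by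
      rw [pow_mul, ← hk, ← zpow_natCast, ← zpow_mul, mul_comm k, zpow_mul, zpow_natCast]
      rw [show (c ^ p ^ N) ^ p = 1 by rw [← pow_mul, ← pow_succ, ← hc, pow_orderOf_eq_one], one_zpow]
    have h2 := orderOf_dvd_of_pow_eq_one h1
    rw [hc, pow_succ] at h2
    exact Nat.dvd_of_mul_dvd_mul_right hp.pos h2

/-- Passing to the quotient by a central subgroup of order `p` meeting `⟨a⟩` trivially. -/
theorem EmbedsInFinitePGroup.of_quotient_of_notMem (hp : p.Prime) {A : Type u} {B : Type v}
    [Group A] [Group B] {a : A} {b : B} (hab : orderOf a = orderOf b) {z : A}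
    (hz : z ∈ Subgroup.center A) (hzp : orderOf z = p) (hza : z ∉ Subgroup.zpowers a)
    (ih : ∀ (A' : Type u) [Group A'] (f : A →* A'), Function.Surjective f →
      f.ker = Subgroup.zpowers z → orderOf (f a) = orderOf b → EmbedsInFinitePGroup p (f a) b) :
    EmbedsInFinitePGroup p a b := by
  have hnorm := Subgroup.normal_zpowers_of_mem_center hz
  have hdisj : ∀ n : ℕ, a ^ n ∈ Subgroup.zpowers z → a ^ n = 1 := by
    rintro n ⟨k, hk : z ^ k = a ^ n⟩
    by_contra hne
    have hpk : ¬ (p : ℤ) ∣ k := fun h => hne (by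
      rw [← hk, ← orderOf_dvd_iff_zpow_eq_one, hzp]; exact h)
    obtain ⟨u, v, huv⟩ := ((Nat.prime_iff_prime_int.1 hp).coprime_iff_not_dvd.2 hpk)
    refine hza ⟨n * v, ?_⟩
    simp only [zpow_mul, zpow_natCast]
    rw [← hk, ← zpow_mul, mul_comm k, eq_sub_of_add_eq' huv, zpow_sub, zpow_one, mul_comm u,
      zpow_mul, zpow_natCast, ← hzp, pow_orderOf_eq_one, one_zpow, inv_one, mul_one]
  have hord : orderOf (a : A ⧸ Subgroup.zpowers z) = orderOf b :=
    (orderOf_mk_of_disjoint hdisj).trans hab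
  obtain ⟨P, _, α, β, hfin, hP, hα, hβ, hαβ⟩ := ih _ (QuotientGroup.mk' (Subgroup.zpowers z))
    (QuotientGroup.mk'_surjective _) (QuotientGroup.ker_mk' _) hord
  obtain ⟨ρ, hρ, hρα, -⟩ := exists_injective_regularWreathProduct hz hzp
    (α := α.comp (QuotientGroup.mk' (Subgroup.zpowers z)))
    (by rw [← MonoidHom.comap_ker, (MonoidHom.ker_eq_bot_iff α).2 hα, MonoidHom.comap_bot,
      QuotientGroup.ker_mk'])
  have hr : (ρ a).right = β b := by rw [hρα]; exact hαβ
  have hb : orderOf (ρ a).right = orderOf b := by rw [hr, orderOf_injective β hβ]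
  refine .of_regularWreathProduct hp hP ρ (RegularWreathProduct.inl.comp β) hρ ?_ ?_ ?_
  · intro x y hxy
    exact hβ (congrArg RegularWreathProduct.right hxy)
  · exact hr
  · rw [hb, ← map_pow, ← map_pow, pow_orderOf_eq_one, ← hab, pow_orderOf_eq_one, map_one, map_one]

/-- Passing to the quotients when `⟨a⟩` and `⟨b⟩` have their subgroups of order `p` central. -/
theorem EmbedsInFinitePGroup.of_quotient_of_mem_center (hp : p.Prime) {A : Type u} {B : Type v}
    [Group A] [Group B] {a : A} {b : B} {N : ℕ} (ha : orderOf a = p ^ (N + 1))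
    (hb : orderOf b = p ^ (N + 1)) (hza : a ^ p ^ N ∈ Subgroup.center A)
    (hzb : b ^ p ^ N ∈ Subgroup.center B)
    (ih : ∀ (A' : Type u) [Group A'] (f : A →* A') (B' : Type v) [Group B'] (g : B →* B'),
      Function.Surjective f → f.ker = Subgroup.zpowers (a ^ p ^ N) →
      Function.Surjective g → g.ker = Subgroup.zpowers (b ^ p ^ N) →
      orderOf (f a) = orderOf (g b) → EmbedsInFinitePGroup p (f a) (g b)) :
    EmbedsInFinitePGroup p a b := by
  have hna := Subgroup.normal_zpowers_of_mem_center hza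
  have hnb := Subgroup.normal_zpowers_of_mem_center hzb
  obtain ⟨P, _, α, β, hfin, hP, hα, hβ, hαβ⟩ := ih _ (QuotientGroup.mk' (Subgroup.zpowers (a ^ p ^ N)))
    _ (QuotientGroup.mk' (Subgroup.zpowers (b ^ p ^ N)))
    (QuotientGroup.mk'_surjective _) (QuotientGroup.ker_mk' _)
    (QuotientGroup.mk'_surjective _) (QuotientGroup.ker_mk' _)
    ((orderOf_mk_zpowers_pow hp ha).trans (orderOf_mk_zpowers_pow hp hb).symm)
  obtain ⟨ρ, hρ, hρα, hρz⟩ := exists_injective_regularWreathProduct hza (orderOf_pow_prime_pow hp ha)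
    (α := α.comp (QuotientGroup.mk' (Subgroup.zpowers (a ^ p ^ N))))
    (by rw [← MonoidHom.comap_ker, (MonoidHom.ker_eq_bot_iff α).2 hα, MonoidHom.comap_bot,
      QuotientGroup.ker_mk'])
  obtain ⟨σ, hσ, hσβ, hσz⟩ := exists_injective_regularWreathProduct hzb (orderOf_pow_prime_pow hp hb)
    (α := β.comp (QuotientGroup.mk' (Subgroup.zpowers (b ^ p ^ N))))
    (by rw [← MonoidHom.comap_ker, (MonoidHom.ker_eq_bot_iff β).2 hβ, MonoidHom.comap_bot,
      QuotientGroup.ker_mk'])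
  have hord : orderOf (ρ a).right = p ^ N := by
    rw [hρα, MonoidHom.comp_apply, orderOf_injective α hα]
    exact orderOf_mk_zpowers_pow hp ha
  refine .of_regularWreathProduct hp hP ρ σ hρ hσ ?_ ?_
  · rw [hρα, hσβ]
    exact hαβ
  · rw [hord, ← map_pow, ← map_pow, hρz, hσz]

theorem IsPGroup.exists_mem_center_orderOf_eq (hp : p.Prime) {A : Type*} [Group A] [Finite A]
    [Nontrivial A] (hA : IsPGroup p A) : ∃ z ∈ Subgroup.center A, orderOf z = p := by
  have : Fact p.Prime := ⟨hp⟩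
  have := hA.center_nontrivial
  obtain ⟨n, hn, hcard⟩ := (hA.to_subgroup (Subgroup.center A)).nontrivial_iff_card.1 this
  obtain ⟨z, hz⟩ := exists_prime_orderOf_dvd_card' (G := Subgroup.center A) p
    (hcard ▸ dvd_pow_self p hn.ne')
  exact ⟨z, z.2, by rw [← hz, Subgroup.orderOf_coe]⟩

theorem pow_mem_zpowers_of_mem_zpowers (hp : p.Prime) {A : Type*} [Group A] {c z : A} {N : ℕ}
    (hc : orderOf c = p ^ (N + 1)) (hz : z ∈ Subgroup.zpowers c) (hzp : orderOf z = p) :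
    c ^ p ^ N ∈ Subgroup.zpowers z := by
  obtain ⟨j, rfl⟩ := hz
  simp only at hzp ⊢
  have hp0 : (p : ℤ) ≠ 0 := by exact_mod_cast hp.ne_zero
  have h1 : c ^ (j * p) = 1 := by rw [zpow_mul, zpow_natCast, ← hzp, pow_orderOf_eq_one]
  have h2 := orderOf_dvd_iff_zpow_eq_one.2 h1
  rw [hc, pow_succ] at h2
  push_cast at h2
  obtain ⟨i, rfl⟩ := (mul_dvd_mul_iff_right hp0).1 h2
  have hpi : ¬ (p : ℤ) ∣ i := by
    rintro ⟨l, rfl⟩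
    have h3 : c ^ ((p : ℤ) ^ N * (p * l)) = 1 := by
      rw [← orderOf_dvd_iff_zpow_eq_one, hc]
      exact ⟨l, by push_cast; ring⟩
    rw [h3, orderOf_one] at hzp
    exact hp.one_lt.ne hzp
  obtain ⟨u, v, huv⟩ := (Nat.prime_iff_prime_int.1 hp).coprime_iff_not_dvd.2 hpi
  refine ⟨v, ?_⟩
  simp only
  rw [← zpow_natCast, ← zpow_mul, zpow_eq_zpow_iff_modEq, hc]
  exact (Int.modEq_iff_dvd.2 ⟨u, by push_cast; linear_combination (p : ℤ) ^ N * (- huv)⟩)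

theorem card_lt_of_ker_eq_zpowers (hp : p.Prime) {C : Type*} {D : Type*} [Group C] [Group D]
    [Finite C] {f : C →* D} {z : C} (hf : Function.Surjective f)
    (hk : f.ker = Subgroup.zpowers z) (hz : orderOf z = p) : Nat.card D < Nat.card C := by
  classical
  have := Finite.of_surjective f hf
  have := Fintype.ofFinite C
  have := Fintype.ofFinite D
  rw [Nat.card_eq_fintype_card, Nat.card_eq_fintype_card]
  refine Fintype.card_lt_of_surjective_not_injective f hf fun hinj => ?_
  rw [(MonoidHom.ker_eq_bot_iff f).2 hinj, eq_comm, Subgroup.zpowers_eq_bot] at hk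
  rw [hk, orderOf_one] at hz
  exact hp.one_lt.ne hz

/-- **Higman's theorem** for cyclic amalgamated subgroups: two finite `p`-groups with elements `a`
and `b` of the same order embed in a finite `p`-group in such a way that `a` and `b` coincide. -/
theorem embedsInFinitePGroup_of_orderOf_eq (hp : p.Prime) (A : Type u) (B : Type v) [Group A]
    [Group B] [Finite A] [Finite B] (a : A) (b : B) (hA : IsPGroup p A) (hB : IsPGroup p B)
    (hab : orderOf a = orderOf b) : EmbedsInFinitePGroup p a b := by
  have : Fact p.Prime := ⟨hp⟩
  obtain ⟨n, hn⟩ : ∃ n, Nat.card A + Nat.card B = n := ⟨_, rfl⟩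
  induction n using Nat.strong_induction_on generalizing A B with
  | _ n ih =>
  have hleft : ∀ z ∈ Subgroup.center A, orderOf z = p → z ∉ Subgroup.zpowers a →
      EmbedsInFinitePGroup p a b := fun z hz hzp hza =>
    .of_quotient_of_notMem hp hab hz hzp hza fun A' _ f hf hk hord => by
      have := Finite.of_surjective f hf
      exact ih _ (by have := card_lt_of_ker_eq_zpowers hp hf hk hzp; omega) A' B _ _
        (hA.of_surjective f hf) hB hord rfl
  have hright : ∀ z ∈ Subgroup.center B, orderOf z = p → z ∉ Subgroup.zpowers b →
      EmbedsInFinitePGroup p a b := fun z hz hzp hzb =>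
    (EmbedsInFinitePGroup.of_quotient_of_notMem hp hab.symm hz hzp hzb fun B' _ f hf hk hord => by
      have := Finite.of_surjective f hf
      exact (ih _ (by have := card_lt_of_ker_eq_zpowers hp hf hk hzp; omega) A B' _ _
        hA (hB.of_surjective f hf) hord.symm rfl).symm).symm
  obtain ⟨M, hM⟩ := IsPGroup.iff_orderOf.1 hA a
  rcases M with _ | N
  · rw [pow_zero, orderOf_eq_one_iff] at hM
    have hb : b = 1 := by rw [← orderOf_eq_one_iff, ← hab, hM, orderOf_one]
    rcases subsingleton_or_nontrivial A with hA' | hA'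
    · rcases subsingleton_or_nontrivial B with hB' | hB'
      · exact ⟨PUnit, inferInstance, 1, 1, inferInstance, .of_subsingleton _ _,
          Function.injective_of_subsingleton _, Function.injective_of_subsingleton _, rfl⟩
      · obtain ⟨z, hz, hzp⟩ := hB.exists_mem_center_orderOf_eq hp
        refine hright z hz hzp fun h => ?_
        rw [hb, Subgroup.zpowers_one_eq_bot, Subgroup.mem_bot] at h
        rw [h, orderOf_one] at hzp
        exact hp.one_lt.ne hzp
    · obtain ⟨z, hz, hzp⟩ := hA.exists_mem_center_orderOf_eq hp
      refine hleft z hz hzp fun h => ?_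
      rw [hM, Subgroup.zpowers_one_eq_bot, Subgroup.mem_bot] at h
      rw [h, orderOf_one] at hzp
      exact hp.one_lt.ne hzp
  · have hMb : orderOf b = p ^ (N + 1) := hab ▸ hM
    by_cases hza : a ^ p ^ N ∈ Subgroup.center A
    · by_cases hzb : b ^ p ^ N ∈ Subgroup.center B
      · refine .of_quotient_of_mem_center hp hM hMb hza hzb
          fun A' _ f B' _ g hf hfk hg hgk hord => ?_
        have := Finite.of_surjective f hf
        have := Finite.of_surjective g hg
        have h1 := card_lt_of_ker_eq_zpowers hp hf hfk (orderOf_pow_prime_pow hp hM)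
        have h2 := card_lt_of_ker_eq_zpowers hp hg hgk (orderOf_pow_prime_pow hp hMb)
        exact ih _ (by omega) A' B' _ _ (hA.of_surjective f hf) (hB.of_surjective g hg) hord rfl
      · have : Nontrivial B := ⟨b ^ p ^ N, 1, fun h => hzb (h ▸ one_mem _)⟩
        obtain ⟨z, hz, hzp⟩ := hB.exists_mem_center_orderOf_eq hp
        exact hright z hz hzp fun h => hzb
          (Subgroup.zpowers_le.2 hz (pow_mem_zpowers_of_mem_zpowers hp hMb h hzp))
    · have : Nontrivial A := ⟨a ^ p ^ N, 1, fun h => hza (h ▸ one_mem _)⟩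
      obtain ⟨z, hz, hzp⟩ := hA.exists_mem_center_orderOf_eq hp
      exact hleft z hz hzp fun h => hza
        (Subgroup.zpowers_le.2 hz (pow_mem_zpowers_of_mem_zpowers hp hM h hzp))

end Amalgam

/-! ### Free groups -/

section FreeGroups

variable {p : ℕ} {X : Type u}

theorem FreeGroup.eq_of_commute_of {a b : X} (h : Commute (FreeGroup.of a) (FreeGroup.of b)) :
    a = b := by
  classical
  by_contra hab
  have h1 : FreeGroup.mk [(a, true), (b, true)] = FreeGroup.mk [(b, true), (a, true)] := h
  have h2 : FreeGroup.IsReduced [(a, true), (b, true)] := by simp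
  have h3 : FreeGroup.IsReduced [(b, true), (a, true)] := by simp
  have h4 := congrArg FreeGroup.toWord h1
  rw [FreeGroup.toWord_mk, FreeGroup.toWord_mk, h2.reduce_eq, h3.reduce_eq] at h4
  simp at h4
  exact hab h4.1

/-- Commuting elements of a free group generate a subgroup that is free and commutative, so they
are powers of a common element. -/
theorem FreeGroup.exists_zpow_eq_zpow_of_commute {f g : FreeGroup X} (h : Commute f g) :
    ∃ x y : ℤ, (x ≠ 0 ∨ y ≠ 0) ∧ f ^ x = g ^ y := by
  let S := Subgroup.closure {f, g}
  have hcomm : ∀ a b : S, a * b = b * a := by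
    have := Subgroup.isMulCommutative_closure (k := {f, g}) (by
      rintro x (rfl | rfl) y (rfl | rfl)
      exacts [rfl, h, h.symm, rfl])
    exact fun a b => this.1.1 a b
  have hsub : Subsingleton (IsFreeGroup.Generators S) := ⟨fun a b =>
    FreeGroup.eq_of_commute_of ((IsFreeGroup.mulEquiv S).injective (by
      rw [_root_.map_mul, _root_.map_mul]; exact hcomm _ _))⟩
  have hcyc : IsCyclic S := by
    have : IsCyclic (FreeGroup (IsFreeGroup.Generators S)) := by
      rcases isEmpty_or_nonempty (IsFreeGroup.Generators S) with he | ⟨⟨a⟩⟩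
      · infer_instance
      · have : Unique (IsFreeGroup.Generators S) := ⟨⟨a⟩, fun b => Subsingleton.elim _ _⟩
        infer_instance
    exact isCyclic_of_surjective (IsFreeGroup.mulEquiv S) (IsFreeGroup.mulEquiv S).surjective
  obtain ⟨c, hc⟩ := hcyc.exists_generator
  obtain ⟨i, hi⟩ := hc ⟨f, Subgroup.subset_closure (by simp)⟩
  obtain ⟨j, hj⟩ := hc ⟨g, Subgroup.subset_closure (by simp)⟩
  have hi' : (c : FreeGroup X) ^ i = f := congrArg Subtype.val hi
  have hj' : (c : FreeGroup X) ^ j = g := congrArg Subtype.val hj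
  by_cases hij : i = 0
  · exact ⟨1, 0, by simp, by rw [← hi', hij]; simp⟩
  · exact ⟨j, i, .inr hij, by rw [← hi', ← hj', ← zpow_mul, ← zpow_mul, mul_comm]⟩

/-- If no letter of the word `L` contributes at its position, the base component of the image of
`L` in a wreath product is trivial. -/
theorem FreeGroup.left_eq_one {D Q : Type*} [Group D] [Group Q] (Φ : FreeGroup X →* D ≀ᵣ Q)
    (L : List (X × Bool)) (q : Q) (h : ∀ M₁ l M₂, L = M₁ ++ l :: M₂ →
      (Φ (FreeGroup.mk [l])).left ((Φ (FreeGroup.mk M₁)).right⁻¹ * q) = 1) :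
    (Φ (FreeGroup.mk L)).left q = 1 := by
  induction L generalizing q with
  | nil =>
    rw [← FreeGroup.one_eq_mk, _root_.map_one]; rfl
  | cons l L ih =>
    have hsplit : ∀ M, FreeGroup.mk (l :: M) = FreeGroup.mk [l] * FreeGroup.mk M := fun M => rfl
    rw [hsplit, _root_.map_mul, RegularWreathProduct.mul_left, Pi.mul_apply]
    have h0 := h [] l L rfl
    rw [← FreeGroup.one_eq_mk, _root_.map_one, RegularWreathProduct.one_right, inv_one, one_mul] at h0
    rw [h0, one_mul]
    refine ih _ fun M₁ l' M₂ hL => ?_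
    have := h (l :: M₁) l' M₂ (by rw [hL]; rfl)
    rwa [hsplit, _root_.map_mul, RegularWreathProduct.mul_right, mul_inv_rev, mul_assoc] at this

/-- A finite `p`-quotient in which the proper subwords of the reduced word `l :: L` are nontrivial
leads to one in which the word itself is nontrivial: the path of the word in the Cayley graph of
the former traverses its first edge just once, which is recorded by a wreath product. -/
theorem FreeGroup.exists_isPOpen_of_proper_subwords (hp : p.Prime) {l : X × Bool}
    {L : List (X × Bool)} (hred : FreeGroup.IsReduced (l :: L)) {N : Subgroup (FreeGroup X)}
    (hN : N.IsPOpen p)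
    (hpre : ∀ M₁ l' M₂, L = M₁ ++ l' :: M₂ → FreeGroup.mk (l :: M₁) ∉ N)
    (hmid : ∀ M₁ l' M₂, L = M₁ ++ l' :: M₂ → M₁ ≠ [] → FreeGroup.mk M₁ ∉ N) :
    ∃ N' : Subgroup (FreeGroup X), N'.IsPOpen p ∧ FreeGroup.mk (l :: L) ∉ N' := by
  classical
  have := hN.normal
  have := hN.finite_quotient hp
  have : NeZero p := ⟨hp.ne_zero⟩
  have : Fact (1 < p) := ⟨hp.one_lt⟩
  let Q := FreeGroup X ⧸ N
  let U := Multiplicative (ZMod p)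
  let π : FreeGroup X →* Q := QuotientGroup.mk' N
  have hπ : ∀ w, π w = 1 ↔ w ∈ N := fun w => QuotientGroup.eq_one_iff w
  obtain ⟨x, s⟩ := l
  -- The vertex at which the letter `x` is recorded.
  let e : Q := if s then 1 else π (FreeGroup.of x)
  let δ : Q → U := fun q => if q = e then Multiplicative.ofAdd 1 else 1
  have hne : (Multiplicative.ofAdd 1 : U) ≠ 1 := fun h => one_ne_zero (α := ZMod p) h
  have hδ : ∀ q, q ≠ e → δ q = 1 := fun q hq => if_neg hq
  have hδe : δ e = Multiplicative.ofAdd 1 := if_pos rfl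
  let Φ : FreeGroup X →* U ≀ᵣ Q := FreeGroup.lift fun y =>
    ⟨if y = x then δ else 1, π (FreeGroup.of y)⟩
  have hright : ∀ w, (Φ w).right = π w := fun w => by
    have : (RegularWreathProduct.rightHom.comp Φ) = π := FreeGroup.ext_hom _ _ fun y => by
      simp [Φ]
    exact DFunLike.congr_fun this w
  have hpos : ∀ y, (Φ (FreeGroup.mk [(y, true)])).left = if y = x then δ else 1 := fun y => by
    simp [Φ]
  have hneg : ∀ y, (Φ (FreeGroup.mk [(y, false)])).left =
      fun q => ((if y = x then δ else 1) (π (FreeGroup.of y) * q))⁻¹ := fun y => by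
    have : FreeGroup.mk [(y, false)] = (FreeGroup.of y)⁻¹ := rfl
    rw [this, _root_.map_inv, RegularWreathProduct.inv_left]
    simp [Φ]
  have hsplit : ∀ M, FreeGroup.mk ((x, s) :: M) = FreeGroup.mk [(x, s)] * FreeGroup.mk M :=
    fun M => rfl
  have hU : IsPGroup p U := IsPGroup.of_card (n := 1) (by simp [U])
  refine ⟨Φ.ker, .ker hp (isPGroup_regularWreathProduct hp hU hN.isPGroup_quotient) Φ, fun hker => ?_⟩
  have h1 : (Φ (FreeGroup.mk ((x, s) :: L))).left 1 = 1 := by rw [MonoidHom.mem_ker.1 hker]; rfl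
  rw [hsplit, _root_.map_mul, RegularWreathProduct.mul_left, Pi.mul_apply, FreeGroup.left_eq_one Φ L,
    mul_one] at h1
  · cases s with
    | true =>
      rw [hpos, if_pos rfl] at h1
      exact hne (hδe.symm.trans h1)
    | false =>
      rw [hneg, if_pos rfl] at h1
      simp only [mul_one] at h1
      exact hne (hδe.symm.trans (inv_eq_one.1 h1))
  · rintro M₁ ⟨y, t⟩ M₂ hL
    rw [← mul_assoc, ← mul_inv_rev, ← RegularWreathProduct.mul_right, ← _root_.map_mul, ← hsplit, hright,
      mul_one]
    by_cases hyx : y = x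
    swap
    · cases t
      · rw [hneg, if_neg hyx]; simp
      · rw [hpos, if_neg hyx]; simp
    subst hyx
    have h2 : π (FreeGroup.mk ((y, s) :: M₁)) ≠ 1 := fun h => hpre _ _ _ hL ((hπ _).1 h)
    have h3 : t ≠ s → π (FreeGroup.mk M₁) ≠ 1 := fun hts h => by
      refine hmid _ _ _ hL ?_ ((hπ _).1 h)
      rintro rfl
      rw [hL] at hred
      simp only [List.nil_append, FreeGroup.isReduced_cons_cons] at hred
      exact hts (hred.1 trivial).symm
    cases s <;> cases t <;> simp only [hpos, hneg, if_true, inv_eq_one] <;> apply hδ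
    · intro h
      apply h2
      simp only [e, Bool.false_eq_true, if_false] at h
      rwa [mul_eq_left, inv_eq_one] at h
    · intro h
      apply h3 (by simp)
      simp only [e, Bool.false_eq_true, if_false] at h
      rw [hsplit, _root_.map_mul, mul_inv_rev, ← _root_.map_inv π (FreeGroup.mk [_])] at h
      have h5 : (FreeGroup.mk [(y, false)])⁻¹ = FreeGroup.of y := rfl
      rw [h5] at h
      rwa [mul_eq_right, inv_eq_one] at h
    · intro h
      apply h3 (by simp)
      simp only [e, if_true] at h
      rw [hsplit, _root_.map_mul, mul_inv_eq_one] at h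
      have h5 : FreeGroup.mk [(y, true)] = FreeGroup.of y := rfl
      rw [h5, left_eq_mul] at h
      exact h
    · intro h
      apply h2
      simpa [e] using h

/-- Free groups are residually `p`-finite, by induction on the length of a reduced word. -/
theorem FreeGroup.isPResidual (hp : p.Prime) (X : Type u) : IsPResidual p (FreeGroup X) := by
  classical
  have key : ∀ (n : ℕ) (L : List (X × Bool)), L.length = n → FreeGroup.IsReduced L → L ≠ [] →
      ∃ N : Subgroup (FreeGroup X), N.IsPOpen p ∧ FreeGroup.mk L ∉ N := by
    intro n
    induction n using Nat.strong_induction_on with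
    | _ n ih =>
    intro L hn hL hne
    obtain ⟨l, L, rfl⟩ := List.exists_cons_of_ne_nil hne
    let T : Set (List (X × Bool)) := {K | K <:+: l :: L ∧ K.length < n ∧ K ≠ []}
    have hT : T.Finite := (List.finite_toSet ((l :: L).sublists)).subset fun K hK =>
      List.mem_sublists.2 hK.1.sublist
    choose! N hN hKN using fun K (hK : K ∈ T) => ih _ hK.2.1 K rfl (hL.infix hK.1) hK.2.2
    refine FreeGroup.exists_isPOpen_of_proper_subwords hp hL
      (N := ⨅ K ∈ hT.toFinset, N K) (.iInf hp _ fun K hK => hN K (by simpa using hK)) ?_ ?_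
    · intro M₁ l' M₂ hM h
      have hmem : l :: M₁ ∈ T := ⟨⟨[], l' :: M₂, by simp [hM]⟩, by rw [← hn, hM]; simp, by simp⟩
      simp only [Subgroup.mem_iInf] at h
      exact hKN _ hmem (h _ (by simpa using hmem))
    · intro M₁ l' M₂ hM hM₁ h
      have hmem : M₁ ∈ T := ⟨⟨[l], l' :: M₂, by simp [hM]⟩, by rw [← hn, hM]; simp, hM₁⟩
      simp only [Subgroup.mem_iInf] at h
      exact hKN _ hmem (h _ (by simpa using hmem))
  intro w hw
  obtain ⟨N, hN, h⟩ := key _ w.toWord rfl FreeGroup.isReduced_toWord (by simpa using hw)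
  exact ⟨N, hN, by rwa [FreeGroup.mk_toWord] at h⟩

end FreeGroups

/-! ### Reduced words in amalgamated products -/

open Monoid PushoutI

section Words

variable {ι : Type*} {A : ι → Type*} {C : Type*} [∀ i, Group (A i)] [Group C]
  {φ : ∀ i, C →* A i}

/-- The element of the amalgamated product spelled by a list of letters. -/
def amalgProd (φ : ∀ i, C →* A i) (l : List (Σ i, A i)) : PushoutI φ :=
  (l.map fun s => of (φ := φ) s.1 s.2).prod

/-- A list of letters is reduced if adjacent letters lie in different factors and no letter lies
in the amalgamated subgroup. -/
def IsAmalgReduced (φ : ∀ i, C →* A i) (l : List (Σ i, A i)) : Prop :=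
  l.IsChain (fun s t => s.1 ≠ t.1) ∧ ∀ s ∈ l, s.2 ∉ (φ s.1).range

/-- A nonempty reduced list is cyclically reduced if its first and last letters lie in different
factors as well. -/
def IsAmalgCyclicallyReduced (φ : ∀ i, C →* A i) (l : List (Σ i, A i)) : Prop :=
  IsAmalgReduced φ l ∧ l ≠ [] ∧ ∀ s ∈ l.getLast?, ∀ t ∈ l.head?, s.1 ≠ t.1

@[simp] theorem amalgProd_nil : amalgProd φ [] = 1 := rfl

@[simp] theorem amalgProd_cons (s : Σ i, A i) (l : List (Σ i, A i)) :
    amalgProd φ (s :: l) = of s.1 s.2 * amalgProd φ l := by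
  simp [amalgProd]

@[simp] theorem amalgProd_append (l l' : List (Σ i, A i)) :
    amalgProd φ (l ++ l') = amalgProd φ l * amalgProd φ l' := by
  simp [amalgProd]

theorem IsAmalgReduced.tail {s : Σ i, A i} {l : List (Σ i, A i)} (h : IsAmalgReduced φ (s :: l)) :
    IsAmalgReduced φ l :=
  ⟨(List.isChain_cons.1 h.1).2, fun t ht => h.2 t (List.mem_cons_of_mem _ ht)⟩

theorem IsAmalgReduced.append {l l' : List (Σ i, A i)} (h : IsAmalgReduced φ l)
    (h' : IsAmalgReduced φ l') (hl : ∀ s ∈ l.getLast?, ∀ t ∈ l'.head?, s.1 ≠ t.1) :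
    IsAmalgReduced φ (l ++ l') := by
  refine ⟨List.isChain_append.2 ⟨h.1, h'.1, hl⟩, fun s hs => ?_⟩
  rcases List.mem_append.1 hs with hs | hs
  exacts [h.2 s hs, h'.2 s hs]

theorem IsAmalgReduced.singleton {i : ι} {a : A i} (ha : a ∉ (φ i).range) :
    IsAmalgReduced φ [⟨i, a⟩] := ⟨List.isChain_singleton _, by simpa using ha⟩

/-- Changing the first letter within its factor. -/
theorem IsAmalgReduced.replace_head {i : ι} {a b : A i} {l : List (Σ i, A i)}
    (h : IsAmalgReduced φ (⟨i, a⟩ :: l)) (hb : b ∉ (φ i).range) :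
    IsAmalgReduced φ (⟨i, b⟩ :: l) := by
  refine ⟨List.isChain_cons.2 ⟨(List.isChain_cons.1 h.1).1, h.tail.1⟩, fun s hs => ?_⟩
  rcases List.mem_cons.1 hs with rfl | hs
  exacts [hb, h.2 s (List.mem_cons_of_mem _ hs)]

theorem IsAmalgReduced.exists_base_mul (c : C) {l : List (Σ i, A i)} (h : IsAmalgReduced φ l)
    (hl : l ≠ []) : ∃ l', IsAmalgReduced φ l' ∧ l' ≠ [] ∧ l'.length = l.length ∧
      amalgProd φ l' = base φ c * amalgProd φ l := by
  obtain ⟨⟨i, a⟩, l, rfl⟩ := List.exists_cons_of_ne_nil hl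
  refine ⟨⟨i, φ i c * a⟩ :: l, h.replace_head fun hmem => ?_, by simp, by simp, ?_⟩
  · exact h.2 _ List.mem_cons_self (((φ i).range.mul_mem_cancel_left ⟨c, rfl⟩).1 hmem)
  · simp [of_apply_eq_base, mul_assoc]

/-- Every element of an amalgamated product lies in the amalgamated subgroup or is spelled by a
nonempty reduced list. -/
theorem exists_isAmalgReduced (g : PushoutI φ) :
    (∃ c, base φ c = g) ∨ ∃ l, IsAmalgReduced φ l ∧ l ≠ [] ∧ amalgProd φ l = g := by
  classical
  let R : PushoutI φ → Prop := fun g =>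
    (∃ c, base φ c = g) ∨ ∃ l, IsAmalgReduced φ l ∧ l ≠ [] ∧ amalgProd φ l = g
  have hbase : ∀ c x, R x → R (base φ c * x) := by
    rintro c x (⟨d, rfl⟩ | ⟨l, hl, hne, rfl⟩)
    · exact .inl ⟨c * d, map_mul _ _ _⟩
    · obtain ⟨l', h1, h2, -, h3⟩ := hl.exists_base_mul c hne
      exact .inr ⟨l', h1, h2, h3⟩
  have hof : ∀ i (a : A i) x, R x → R (of i a * x) := by
    intro i a x hx
    by_cases ha : a ∈ (φ i).range
    · obtain ⟨c, rfl⟩ := ha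
      rw [of_apply_eq_base]
      exact hbase c x hx
    rcases hx with ⟨d, rfl⟩ | ⟨l, hl, hne, rfl⟩
    · refine .inr ⟨[⟨i, a * φ i d⟩], .singleton fun h => ha ?_, by simp, ?_⟩
      · exact ((φ i).range.mul_mem_cancel_right ⟨d, rfl⟩).1 h
      · simp [of_apply_eq_base]
    obtain ⟨⟨j, b⟩, l, rfl⟩ := List.exists_cons_of_ne_nil hne
    by_cases hij : i = j
    · subst hij
      by_cases hab : a * b ∈ (φ i).range
      · obtain ⟨c, hc⟩ := hab
        have : of i a * amalgProd φ (⟨i, b⟩ :: l) = base φ c * amalgProd φ l := by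
          rw [amalgProd_cons, ← mul_assoc, ← map_mul, ← hc, of_apply_eq_base]
        rw [this]
        refine hbase c _ ?_
        rcases eq_or_ne l [] with rfl | hl'
        · exact .inl ⟨1, map_one _⟩
        · exact .inr ⟨l, hl.tail, hl', rfl⟩
      · exact .inr ⟨⟨i, a * b⟩ :: l, hl.replace_head hab, by simp, by simp [mul_assoc]⟩
    · refine .inr ⟨⟨i, a⟩ :: ⟨j, b⟩ :: l, (IsAmalgReduced.singleton ha).append hl ?_, by simp,
        by simp⟩
      simpa using hij
  have hmul : ∀ g x, R x → R (g * x) := fun g => by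
    induction g using PushoutI.induction_on with
    | of i a => exact hof i a
    | base c => exact hbase c
    | mul x y hx hy => exact fun z hz => by rw [mul_assoc]; exact hx _ (hy _ hz)
  simpa using hmul g 1 (.inl ⟨1, map_one _⟩)

theorem IsAmalgReduced.amalgProd_ne_one (hφ : ∀ i, Function.Injective (φ i))
    {l : List (Σ i, A i)} (h : IsAmalgReduced φ l) (hl : l ≠ []) : amalgProd φ l ≠ 1 := by
  intro h1
  let w : CoprodI.Word A := ⟨l, fun s hs h' => h.2 s hs (h' ▸ one_mem _), h.1⟩
  have hw : ofCoprodI (φ := φ) w.prod = amalgProd φ l := by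
    simp only [CoprodI.Word.prod, map_list_prod, List.map_map, amalgProd, w]
    congr 1
  have := Reduced.eq_empty_of_mem_range hφ (w := w) (fun s hs => h.2 s hs)
    (by rw [hw, h1]; exact one_mem _)
  exact hl (congrArg CoprodI.Word.toList this)

theorem IsAmalgCyclicallyReduced.exists_pow {l : List (Σ i, A i)}
    (h : IsAmalgCyclicallyReduced φ l) (n : ℕ) :
    ∃ l', IsAmalgReduced φ l' ∧ l'.head? = l.head? ∧ amalgProd φ l' = amalgProd φ l ^ (n + 1) := by
  induction n with
  | zero => exact ⟨l, h.1, rfl, by simp⟩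
  | succ n ih =>
    obtain ⟨l', h1, h2, h3⟩ := ih
    refine ⟨l ++ l', h.1.append h1 (by rw [h2]; exact h.2.2), ?_, ?_⟩
    · rw [List.head?_append_of_ne_nil _ h.2.1]
    · rw [amalgProd_append, h3, ← pow_succ']

theorem IsAmalgCyclicallyReduced.not_isOfFinOrder (hφ : ∀ i, Function.Injective (φ i))
    {l : List (Σ i, A i)} (h : IsAmalgCyclicallyReduced φ l) : ¬ IsOfFinOrder (amalgProd φ l) := by
  rw [isOfFinOrder_iff_pow_eq_one]
  rintro ⟨n, hn, h1⟩
  obtain ⟨m, rfl⟩ := Nat.exists_eq_succ_of_ne_zero hn.ne'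
  obtain ⟨l', h2, h3, h4⟩ := h.exists_pow m
  refine h2.amalgProd_ne_one hφ ?_ (h4.trans h1)
  rintro rfl
  exact h.2.1 (List.head?_eq_none_iff.1 h3.symm)

/-- A reduced list of minimal length in its conjugacy class is cyclically reduced or a single
letter. -/
theorem IsAmalgReduced.exists_conj {l : List (Σ i, A i)} (h : IsAmalgReduced φ l) (hl : l ≠ []) :
    ∃ c : PushoutI φ, (∃ i a, c * amalgProd φ l * c⁻¹ = of i a) ∨
      ∃ l', IsAmalgCyclicallyReduced φ l' ∧ c * amalgProd φ l * c⁻¹ = amalgProd φ l' := by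
  obtain ⟨n, hn⟩ : ∃ n, l.length = n := ⟨_, rfl⟩
  induction n using Nat.strong_induction_on generalizing l with
  | _ n ih =>
  obtain ⟨⟨i, a⟩, l, rfl⟩ := List.exists_cons_of_ne_nil hl
  rcases List.eq_nil_or_concat l with rfl | ⟨m, ⟨j, b⟩, hcat⟩
  · exact ⟨1, .inl ⟨i, a, by simp⟩⟩
  rw [List.concat_eq_append] at hcat
  subst hcat
  by_cases hij : j = i
  swap
  · exact ⟨1, .inr ⟨_, ⟨h, hl, by simpa [List.getLast?_cons] using hij⟩, by simp⟩⟩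
  subst hij
  have hm : m ≠ [] := by
    rintro rfl
    exact (List.isChain_cons_cons.1 h.1).1 rfl
  have hchain : IsAmalgReduced φ (⟨j, a⟩ :: m) :=
    ⟨h.1.left_of_append (l₁ := ⟨j, a⟩ :: m), fun s hs => h.2 s (by
      rw [← List.cons_append]; exact List.mem_append_left _ hs)⟩
  have hconj : of j b * amalgProd φ (⟨j, a⟩ :: (m ++ [⟨j, b⟩])) * (of j b)⁻¹ =
      of j (b * a) * amalgProd φ m := by
    simp [mul_assoc]
  -- Cyclic permutation and merging produce a shorter reduced list.
  obtain ⟨l', hl', hne, hlen, hprod⟩ : ∃ l', IsAmalgReduced φ l' ∧ l' ≠ [] ∧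
      l'.length < n ∧ amalgProd φ l' = of j (b * a) * amalgProd φ m := by
    by_cases hba : b * a ∈ (φ j).range
    · obtain ⟨c, hc⟩ := hba
      obtain ⟨l', h1, h2, h3, h4⟩ := hchain.tail.exists_base_mul c hm
      refine ⟨l', h1, h2, ?_, by rw [h4, ← hc, of_apply_eq_base]⟩
      rw [h3, ← hn]
      simp
    · refine ⟨⟨j, b * a⟩ :: m, hchain.replace_head hba, by simp, ?_, by simp⟩
      rw [← hn]
      simp
  obtain ⟨c, hc⟩ := ih _ hlen hl' hne rfl
  refine ⟨c * of j b, ?_⟩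
  have : c * of j b * amalgProd φ (⟨j, a⟩ :: (m ++ [⟨j, b⟩])) * (c * of j b)⁻¹ =
      c * amalgProd φ l' * c⁻¹ := by
    rw [hprod, ← hconj]
    group
  rw [this]
  exact hc

theorem PushoutI.exists_conj [Nonempty ι] (g : PushoutI φ) :
    ∃ c : PushoutI φ, (∃ i a, c * g * c⁻¹ = of i a) ∨
      ∃ l, IsAmalgCyclicallyReduced φ l ∧ c * g * c⁻¹ = amalgProd φ l := by
  rcases exists_isAmalgReduced g with ⟨c, rfl⟩ | ⟨l, hl, hne, rfl⟩
  · obtain ⟨i⟩ := ‹Nonempty ι›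
    exact ⟨1, .inl ⟨i, φ i c, by simp [of_apply_eq_base]⟩⟩
  · exact hl.exists_conj hne

/-- The list spelling the inverse. -/
def amalgInv (l : List (Σ i, A i)) : List (Σ i, A i) := (l.map fun s => ⟨s.1, s.2⁻¹⟩).reverse

theorem amalgProd_amalgInv (l : List (Σ i, A i)) :
    amalgProd φ (amalgInv l) = (amalgProd φ l)⁻¹ := by
  induction l with
  | nil => simp [amalgInv]
  | cons s l ih =>
    have : amalgInv (s :: l) = amalgInv l ++ [⟨s.1, s.2⁻¹⟩] := by simp [amalgInv]
    rw [this, amalgProd_append, ih]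
    simp

theorem IsAmalgReduced.amalgInv {l : List (Σ i, A i)} (h : IsAmalgReduced φ l) :
    IsAmalgReduced φ (amalgInv l) := by
  refine ⟨?_, fun s hs => ?_⟩
  · rw [_root_.amalgInv, List.isChain_reverse, List.isChain_map]
    exact h.1.imp fun _ _ h => h.symm
  · simp only [_root_.amalgInv, List.mem_reverse, List.mem_map] at hs
    obtain ⟨t, ht, rfl⟩ := hs
    simpa using h.2 t ht

/-- Commuting elements `of i a` and `c * of j b * c⁻¹` of the amalgamated product are
simultaneously conjugate into one factor: otherwise, for `c` spelled by the shortest possible list,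
their commutator is spelled by a reduced list. In the Bass–Serre tree, commuting elliptic elements
have a common fixed vertex. -/
theorem exists_conj_mem_common_factor_aux (hφ : ∀ i, Function.Injective (φ i))
    (n : ℕ) : ∀ (l : List (Σ i, A i)) (i j : ι) (a : A i) (b : A j), l.length = n →
      IsAmalgReduced φ l →
      Commute (of (φ := φ) i a) (amalgProd φ l * of j b * (amalgProd φ l)⁻¹) →
      ∃ (d : PushoutI φ) (k : ι) (a' b' : A k), d * of i a * d⁻¹ = of k a' ∧
        d * (amalgProd φ l * of j b * (amalgProd φ l)⁻¹) * d⁻¹ = of k b' := by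
  induction n with
  | zero =>
    intro l i j a b hl _ hc
    rw [List.length_eq_zero_iff] at hl
    subst hl
    simp only [amalgProd_nil, one_mul, inv_one, mul_one] at hc ⊢
    by_cases hij : i = j
    · subst hij
      exact ⟨1, i, a, b, by simp, by simp⟩
    by_cases ha : a ∈ (φ i).range
    · obtain ⟨c, rfl⟩ := ha
      exact ⟨1, j, φ j c, b, by simp [of_apply_eq_base], by simp⟩
    by_cases hb : b ∈ (φ j).range
    · obtain ⟨c, rfl⟩ := hb
      exact ⟨1, i, a, φ i c, by simp, by simp [of_apply_eq_base]⟩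
    exfalso
    refine IsAmalgReduced.amalgProd_ne_one (l := [⟨i, a⟩, ⟨j, b⟩, ⟨i, a⁻¹⟩, ⟨j, b⁻¹⟩]) hφ ?_
      (by simp) ?_
    · refine ⟨by simp [hij, Ne.symm hij], ?_⟩
      simp only [List.mem_cons, List.not_mem_nil, or_false]
      rintro s (rfl | rfl | rfl | rfl)
      exacts [ha, hb, by simpa using ha, by simpa using hb]
    · simp only [amalgProd_cons, amalgProd_nil, mul_one, map_inv]
      rw [← mul_assoc, hc.eq]
      group
  | succ n ih =>
    intro l i j a b hl hred hc
    obtain ⟨⟨i', x⟩, m, rfl⟩ := List.exists_cons_of_length_eq_add_one hl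
    -- If `of i a` lies in the factor of the first letter, conjugate by that letter.
    have hfirst : ∀ a' : A i', of (φ := φ) i' a' = of i a →
        ∃ (d : PushoutI φ) (k : ι) (a' b' : A k), d * of i a * d⁻¹ = of k a' ∧
        d * (amalgProd φ (⟨i', x⟩ :: m) * of j b * (amalgProd φ (⟨i', x⟩ :: m))⁻¹) * d⁻¹ =
          of k b' := by
      intro a' ha'
      obtain ⟨d, k, a₁, b₁, h1, h2⟩ := ih m i' j (x⁻¹ * a' * x) b (by simpa using hl) hred.tail (by
        rw [← Commute.conj_iff (of i' x)⁻¹] at hc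
        rw [← ha', amalgProd_cons] at hc
        simpa [mul_assoc] using hc)
      refine ⟨d * (of i' x)⁻¹, k, a₁, b₁, ?_, ?_⟩
      · rw [← h1, ← ha']
        simp [mul_assoc]
      · rw [← h2]
        simp [mul_assoc]
    by_cases hii : i' = i
    · subst hii
      exact hfirst a rfl
    by_cases ha : a ∈ (φ i).range
    · obtain ⟨c, rfl⟩ := ha
      exact hfirst (φ i' c) (by rw [of_apply_eq_base, of_apply_eq_base])
    -- If `of j b` lies in the factor of the last letter, drop that letter.
    obtain ⟨m', ⟨j', y⟩, hm'⟩ := List.eq_nil_or_concat (⟨i', x⟩ :: m) |>.resolve_left (by simp)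
    rw [List.concat_eq_append] at hm'
    rw [hm'] at hred hl hc ⊢
    have hred' : IsAmalgReduced φ m' :=
      ⟨hred.1.left_of_append, fun s hs => hred.2 s (List.mem_append_left _ hs)⟩
    have hlast : ∀ b' : A j', of (φ := φ) j' b' = of j b →
        ∃ (d : PushoutI φ) (k : ι) (a' b' : A k), d * of i a * d⁻¹ = of k a' ∧
        d * (amalgProd φ (m' ++ [⟨j', y⟩]) * of j b * (amalgProd φ (m' ++ [⟨j', y⟩]))⁻¹) * d⁻¹ =
          of k b' := by
      intro b' hb'
      have heq : amalgProd φ (m' ++ [⟨j', y⟩]) * of j b * (amalgProd φ (m' ++ [⟨j', y⟩]))⁻¹ =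
          amalgProd φ m' * of j' (y * b' * y⁻¹) * (amalgProd φ m')⁻¹ := by
        rw [← hb']
        simp [mul_assoc]
      rw [heq] at hc ⊢
      exact ih m' i j' a (y * b' * y⁻¹) (by simpa using hl) hred' hc
    by_cases hjj : j' = j
    · subst hjj
      exact hlast b rfl
    by_cases hb : b ∈ (φ j).range
    · obtain ⟨c, rfl⟩ := hb
      exact hlast (φ j' c) (by rw [of_apply_eq_base, of_apply_eq_base])
    exfalso
    rw [← hm'] at hred hc
    set l := (⟨i', x⟩ : Σ i, A i) :: m with hldef
    have hhead : ∀ s ∈ l.head?, s.1 ≠ i := by simpa [hldef] using hii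
    have hlst : ∀ s ∈ l.getLast?, s.1 ≠ j := by rw [hm']; simpa using hjj
    have hlne : l ≠ [] := by simp [hldef]
    have hihead : ∀ s ∈ (amalgInv l).head?, s.1 ≠ j := by
      intro s hs
      rw [amalgInv, List.head?_reverse, List.getLast?_map] at hs
      simp only [Option.mem_def, Option.map_eq_some_iff] at hs
      obtain ⟨t, ht, rfl⟩ := hs
      exact hlst t ht
    have hilast : ∀ s ∈ (amalgInv l).getLast?, s.1 ≠ i := by
      intro s hs
      rw [amalgInv, List.getLast?_reverse, List.head?_map] at hs
      simp only [Option.mem_def, Option.map_eq_some_iff] at hs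
      obtain ⟨t, ht, rfl⟩ := hs
      exact hhead t ht
    have hine : amalgInv l ≠ [] := by simp [amalgInv, hlne]
    have ha' : a⁻¹ ∉ (φ i).range := by simpa using ha
    have hb' : b⁻¹ ∉ (φ j).range := by simpa using hb
    -- The reduced list spelling the commutator.
    have hblock : ∀ (a : A i) (b : A j), a ∉ (φ i).range → b ∉ (φ j).range →
        IsAmalgReduced φ ([⟨i, a⟩] ++ (l ++ ([⟨j, b⟩] ++ amalgInv l))) := by
      intro a b ha hb
      refine (IsAmalgReduced.singleton ha).append (hred.append
        ((IsAmalgReduced.singleton hb).append hred.amalgInv ?_) ?_) ?_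
      · intro s hs t ht
        simp only [List.getLast?_singleton, Option.mem_def, Option.some.injEq] at hs
        subst hs
        exact (hihead t ht).symm
      · intro s hs t ht
        simp only [List.cons_append, List.head?_cons, Option.mem_def, Option.some.injEq] at ht
        subst ht
        exact hlst s hs
      · intro s hs t ht
        simp only [List.getLast?_singleton, Option.mem_def, Option.some.injEq] at hs
        subst hs
        rw [List.head?_append_of_ne_nil _ hlne] at ht
        exact (hhead t ht).symm
    have hbig := (hblock a b ha hb).append (hblock a⁻¹ b⁻¹ ha' hb') (by
      intro s hs t ht
      rw [List.getLast?_append_of_ne_nil _ (by simp), List.getLast?_append_of_ne_nil _ (by simp),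
        List.getLast?_append_of_ne_nil _ hine] at hs
      simp only [List.cons_append, List.head?_cons, Option.mem_def, Option.some.injEq] at ht
      subst ht
      exact hilast s hs)
    refine hbig.amalgProd_ne_one hφ (by simp) ?_
    simp only [amalgProd_append, amalgProd_amalgInv, amalgProd_cons, amalgProd_nil, mul_one, map_inv]
    have h5 := hc.eq
    set u := amalgProd φ l
    calc _ = (of i a * (u * of j b * u⁻¹)) * (of i a)⁻¹ * (u * of j b * u⁻¹)⁻¹ := by group
      _ = 1 := by rw [h5]; group

theorem exists_conj_mem_common_factor (hφ : ∀ i, Function.Injective (φ i)) {i j : ι} {a : A i}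
    {b : A j} {c : PushoutI φ} (hc : Commute (of (φ := φ) i a) (c * of j b * c⁻¹)) :
    ∃ (d : PushoutI φ) (k : ι) (a' b' : A k), d * of i a * d⁻¹ = of k a' ∧
      d * (c * of j b * c⁻¹) * d⁻¹ = of k b' := by
  rcases exists_isAmalgReduced c with ⟨h, rfl⟩ | ⟨l, hl, -, rfl⟩
  · have heq : base φ h * of j b * (base φ h)⁻¹ = of j (φ j h * b * (φ j h)⁻¹) := by
      simp [of_apply_eq_base]
    rw [heq] at hc ⊢
    have := exists_conj_mem_common_factor_aux hφ 0 [] i j a (φ j h * b * (φ j h)⁻¹) rfl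
      ⟨List.isChain_nil, by simp⟩ (by simpa using hc)
    simpa using this
  · exact exists_conj_mem_common_factor_aux hφ _ l i j a b rfl hl hc

end Words

/-! ### Amalgams of subgroups of a finite group -/

section Wreath

variable {P : Type*} [Group P] {ι : Type*} {S : ι → Subgroup P} {C : Subgroup P}

/-- The free generator attached to the factor `i` and the coset `x⁻¹ C`. The pairs `(i, y C)` are
the edges of the quotient of the Bass–Serre tree of the amalgam by the kernel of the map to `P`,
joining the vertex `y C` to the vertex `y S i`. -/
def amalgCocycle (C : Subgroup P) (i : ι) (x : P) : FreeGroup (ι × P ⧸ C) :=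
  FreeGroup.of (i, ((x⁻¹ : P) : P ⧸ C))

/-- The homomorphism of an amalgam of subgroups of `P` to the wreath product of a free group and `P`
whose second component is the canonical map to `P`, and whose first component records the edges
traversed by a path: a letter from `S i` leads along an edge of type `i` and back along another. -/
def amalgToWreath (hC : ∀ i, C ≤ S i) :
    PushoutI (fun i => Subgroup.inclusion (hC i)) →* FreeGroup (ι × P ⧸ C) ≀ᵣ P :=
  PushoutI.lift
    (fun i =>
      { toFun := fun s => ⟨fun x => (amalgCocycle C i x)⁻¹ * amalgCocycle C i ((s : P)⁻¹ * x), s⟩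
        map_one' := by ext <;> simp
        map_mul' := fun s t => by ext <;> simp [mul_assoc] })
    (RegularWreathProduct.inl.comp C.subtype) fun i => by
      ext c
      · simp only [amalgCocycle, MonoidHom.coe_comp, Function.comp_apply, MonoidHom.coe_mk,
          OneHom.coe_mk, Subgroup.coe_inclusion, Subgroup.coe_subtype,
          RegularWreathProduct.left_inl, Pi.one_apply, inv_mul_eq_one]
        congr 2
        rw [QuotientGroup.eq]
        simp
      · simp

/-- The reduced word in the free group spelling the component at `x` of the image of a reduced
list. -/
def amalgWord (C : Subgroup P) : List (Σ i, S i) → P → List ((ι × P ⧸ C) × Bool)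
  | [], _ => []
  | ⟨i, s⟩ :: l, x => ((i, ((x⁻¹ : P) : P ⧸ C)), false) ::
      ((i, ((x⁻¹ * s : P) : P ⧸ C)), true) :: amalgWord C l ((s : P)⁻¹ * x)

theorem mk_amalgWord (hC : ∀ i, C ≤ S i) (l : List (Σ i, S i)) (x : P) :
    FreeGroup.mk (amalgWord C l x) =
      (amalgToWreath hC (amalgProd (fun i => Subgroup.inclusion (hC i)) l)).left x := by
  induction l generalizing x with
  | nil => simp [amalgWord, FreeGroup.one_eq_mk]
  | cons s l ih =>
    obtain ⟨i, s⟩ := s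
    have : amalgWord C (⟨i, s⟩ :: l) x = [((i, ((x⁻¹ : P) : P ⧸ C)), false)] ++
      ([((i, ((x⁻¹ * s : P) : P ⧸ C)), true)] ++ amalgWord C l ((s : P)⁻¹ * x)) := rfl
    rw [this, ← FreeGroup.mul_mk, ← FreeGroup.mul_mk, ih, amalgProd_cons, map_mul]
    simp [amalgToWreath, amalgCocycle, FreeGroup.of, FreeGroup.inv_mk, FreeGroup.invRev,
      ← mul_assoc]

theorem isReduced_amalgWord (hC : ∀ i, C ≤ S i) {l : List (Σ i, S i)}
    (hl : IsAmalgReduced (fun i => Subgroup.inclusion (hC i)) l) (x : P) :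
    FreeGroup.IsReduced (amalgWord C l x) := by
  induction l generalizing x with
  | nil => simp [amalgWord]
  | cons s l ih =>
    have hs := hl.2 s List.mem_cons_self
    obtain ⟨i, s⟩ := s
    have hsC : (s : P) ∉ C := fun h => hs ⟨⟨s, h⟩, rfl⟩
    have hw := ih hl.tail ((s : P)⁻¹ * x)
    rw [amalgWord, FreeGroup.IsReduced, List.isChain_cons_cons, List.isChain_cons]
    refine ⟨fun h => absurd (Prod.ext_iff.1 h).2 ?_, fun t ht h => ?_, hw⟩
    · rw [QuotientGroup.eq]
      simpa using hsC
    · cases l with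
      | nil => simp [amalgWord] at ht
      | cons t' l =>
        obtain ⟨j, t'⟩ := t'
        simp only [amalgWord, List.head?_cons, Option.mem_def, Option.some.injEq] at ht
        subst ht
        exact absurd (Prod.ext_iff.1 h).1 (List.isChain_cons_cons.1 hl.1).1

/-- The kernel of the map to `P` embeds in the free group: the path of a nontrivial reduced list
never backtracks. -/
theorem eq_one_of_amalgToWreath (hC : ∀ i, C ≤ S i)
    {u : PushoutI (fun i => Subgroup.inclusion (hC i))}
    (h1 : (amalgToWreath hC u).right = 1) (h2 : (amalgToWreath hC u).left 1 = 1) : u = 1 := by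
  classical
  rcases exists_isAmalgReduced u with ⟨c, rfl⟩ | ⟨l, hl, hne, rfl⟩
  · have : c = 1 := by simpa [amalgToWreath] using h1
    rw [this, map_one]
  · rw [← mk_amalgWord, FreeGroup.one_eq_mk] at h2
    have h3 := FreeGroup.reduce.sound h2
    rw [(isReduced_amalgWord hC hl 1).reduce_eq, FreeGroup.reduce_nil] at h3
    obtain ⟨⟨i, s⟩, l, rfl⟩ := List.exists_cons_of_ne_nil hne
    simp [amalgWord] at h3

theorem amalgToWreath_injective (hC : ∀ i, C ≤ S i) : Function.Injective (amalgToWreath hC) := by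
  rw [injective_iff_map_eq_one]
  intro u hu
  exact eq_one_of_amalgToWreath hC (by rw [hu]; rfl) (by rw [hu]; rfl)

theorem IsPResidual.regularWreathProduct {p : ℕ} (hp : p.Prime) {F : Type*} [Group F] [Finite P]
    (hF : IsPResidual p F) (hP : IsPGroup p P) : IsPResidual p (F ≀ᵣ P) := by
  intro w hw
  by_cases hr : w.right = 1
  · obtain ⟨x, hx⟩ : ∃ x, w.left x ≠ 1 := by
      by_contra! h
      exact hw (RegularWreathProduct.ext (funext h) hr)
    obtain ⟨N, hN, hxN⟩ := hF _ hx
    have := hN.normal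
    have := hN.finite_quotient hp
    let ψ : F ≀ᵣ P →* (F ⧸ N) ≀ᵣ P :=
      { toFun := fun w => ⟨fun x => (w.left x : F ⧸ N), w.right⟩
        map_one' := rfl
        map_mul' := fun _ _ => rfl }
    refine ⟨ψ.ker, .ker hp (isPGroup_regularWreathProduct hp hN.isPGroup_quotient hP) ψ,
      fun h => hxN ?_⟩
    have h1 : ψ w = 1 := h
    rw [← QuotientGroup.eq_one_iff]
    exact congrFun (congrArg RegularWreathProduct.left h1) x
  · exact ⟨_, .ker hp hP RegularWreathProduct.rightHom, hr⟩

theorem IsPResidual.of_injective {p : ℕ} (hp : p.Prime) {X Y : Type*} [Group X] [Group Y]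
    (hY : IsPResidual p Y) {f : X →* Y} (hf : Function.Injective f) : IsPResidual p X := by
  intro x hx
  obtain ⟨N, hN, h⟩ := hY (f x) (by rwa [Ne, map_eq_one_iff f hf])
  exact ⟨N.comap f, hN.comap hp f, h⟩

theorem isPResidual_amalgam {p : ℕ} (hp : p.Prime) [Finite P] (hP : IsPGroup p P)
    (hC : ∀ i, C ≤ S i) : IsPResidual p (PushoutI (fun i => Subgroup.inclusion (hC i))) :=
  ((FreeGroup.isPResidual hp _).regularWreathProduct hp hP).of_injective hp
    (amalgToWreath_injective hC)

/-- Commuting elements of an amalgam of subgroups of a finite group generate a virtually cyclic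
group, because the amalgam is virtually free. -/
theorem exists_zpow_eq_zpow_of_commute_amalgam [Finite P] (hC : ∀ i, C ≤ S i)
    {f g : PushoutI (fun i => Subgroup.inclusion (hC i))} (h : Commute f g) :
    ∃ x y : ℤ, (x ≠ 0 ∨ y ≠ 0) ∧ f ^ x = g ^ y := by
  let K := (RegularWreathProduct.rightHom.comp (amalgToWreath hC)).ker
  let χ : K →* FreeGroup (ι × P ⧸ C) :=
    { toFun := fun u => (amalgToWreath hC u).left 1
      map_one' := by simp
      map_mul' := fun u v => by
        have hu : (amalgToWreath hC u).right = 1 := u.2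
        simp [hu] }
  have hχ : Function.Injective χ := by
    rw [injective_iff_map_eq_one]
    intro u hu
    exact Subtype.ext (eq_one_of_amalgToWreath hC u.2 hu)
  have hK : ∀ u, u ^ Nat.card P ∈ K := fun u => by
    rw [MonoidHom.mem_ker, map_pow, pow_card_eq_one']
  have hcard : (Nat.card P : ℤ) ≠ 0 := by exact_mod_cast Nat.card_pos.ne'
  have hc : Commute (⟨_, hK f⟩ : K) ⟨_, hK g⟩ := Subtype.ext (h.pow_pow _ _)
  obtain ⟨x, y, hxy, he⟩ := FreeGroup.exists_zpow_eq_zpow_of_commute (hc.map χ)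
  rw [← map_zpow, ← map_zpow] at he
  have he' := congrArg Subtype.val (hχ he)
  refine ⟨Nat.card P * x, Nat.card P * y, hxy.imp (mul_ne_zero hcard) (mul_ne_zero hcard), ?_⟩
  simpa [zpow_mul] using he'

end Wreath

/-! ### Separation in amalgamated products with compatible `p`-quotients -/

section Fold

variable {ι : Type*} {A : ι → Type*} {C : Type*} [∀ i, Group (A i)] [Group C]
  {φ : ∀ i, C →* A i}

/-- The image of the `i`-th factor in the quotient of the amalgamated product by `N`. -/
abbrev factorImage (φ : ∀ i, C →* A i) (N : Subgroup (PushoutI φ)) [N.Normal] (i : ι) :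
    Subgroup (PushoutI φ ⧸ N) :=
  ((QuotientGroup.mk' N).comp (of i)).range

/-- The image of the amalgamated subgroup in the quotient of the amalgamated product by `N`. -/
abbrev baseImage (φ : ∀ i, C →* A i) (N : Subgroup (PushoutI φ)) [N.Normal] :
    Subgroup (PushoutI φ ⧸ N) :=
  ((QuotientGroup.mk' N).comp (base φ)).range

theorem baseImage_le (N : Subgroup (PushoutI φ)) [N.Normal] (i : ι) :
    baseImage φ N ≤ factorImage φ N i := by
  rintro _ ⟨c, rfl⟩
  exact ⟨φ i c, by simp [of_apply_eq_base]⟩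

/-- The amalgam of the images of the factors in the quotient of the amalgamated product by `N`. -/
abbrev AmalgamImage (φ : ∀ i, C →* A i) (N : Subgroup (PushoutI φ)) [N.Normal] :=
  PushoutI fun i => Subgroup.inclusion (baseImage_le (φ := φ) N i)

/-- The homomorphism of an amalgamated product to the amalgam of the images of its factors in the
quotient by `N`. -/
def amalgFold (N : Subgroup (PushoutI φ)) [N.Normal] : PushoutI φ →* AmalgamImage φ N :=
  PushoutI.lift (fun i => (of i).comp ((QuotientGroup.mk' N).comp (of i)).rangeRestrict)
    ((base _).comp ((QuotientGroup.mk' N).comp (base φ)).rangeRestrict) fun i => by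
      ext c
      simp only [MonoidHom.comp_apply]
      rw [← of_apply_eq_base (fun i => Subgroup.inclusion (baseImage_le (φ := φ) N i)) i]
      congr 1
      exact Subtype.ext (by simp [of_apply_eq_base])

theorem amalgFold_of (N : Subgroup (PushoutI φ)) [N.Normal] (i : ι) (a : A i) :
    amalgFold N (of i a) = of (φ := fun i => Subgroup.inclusion (baseImage_le (φ := φ) N i)) i
      (⟨(of (φ := φ) i a : PushoutI φ), a, rfl⟩ : factorImage φ N i) := by
  simp only [amalgFold, lift_of]
  rfl

theorem amalgFold_base (N : Subgroup (PushoutI φ)) [N.Normal] (c : C) :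
    amalgFold N (base φ c) = base (fun i => Subgroup.inclusion (baseImage_le (φ := φ) N i))
      (⟨(base φ c : PushoutI φ), c, rfl⟩ : baseImage φ N) := by
  simp only [amalgFold, lift_base]
  rfl

/-- For `N ≤ N'` the homomorphism to the amalgam of the images modulo `N'` factors through that of
the images modulo `N`. -/
theorem ker_amalgFold_le {N N' : Subgroup (PushoutI φ)} [N.Normal] [N'.Normal] (h : N ≤ N') :
    (amalgFold N).ker ≤ (amalgFold N').ker := by
  let δ : PushoutI φ ⧸ N →* PushoutI φ ⧸ N' := QuotientGroup.map N N' (.id _) h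
  have h1 : ∀ i, ∀ x : factorImage φ N i, δ x ∈ factorImage φ N' i := by
    rintro i ⟨_, a, rfl⟩
    exact ⟨a, rfl⟩
  have h2 : ∀ x : baseImage φ N, δ x ∈ baseImage φ N' := by
    rintro ⟨_, a, rfl⟩
    exact ⟨a, rfl⟩
  let Δ : AmalgamImage φ N →* AmalgamImage φ N' := PushoutI.lift
    (fun i => (of i).comp ((δ.comp (factorImage φ N i).subtype).codRestrict _ (h1 i)))
    ((base _).comp ((δ.comp (baseImage φ N).subtype).codRestrict _ h2)) fun i => by
      ext c
      simp only [MonoidHom.comp_apply]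
      rw [← of_apply_eq_base (fun i => Subgroup.inclusion (baseImage_le (φ := φ) N' i)) i]
      rfl
  have hΔ : Δ.comp (amalgFold N) = amalgFold N' := by
    refine PushoutI.hom_ext (fun i => ?_) ?_
    · ext a
      simp only [MonoidHom.comp_apply, amalgFold_of, Δ, lift_of]
      rfl
    · ext a
      simp only [MonoidHom.comp_apply, amalgFold_base, Δ, lift_base]
      rfl
  intro x hx
  rw [MonoidHom.mem_ker] at hx ⊢
  rw [← hΔ, MonoidHom.comp_apply, hx, map_one]

/-- The list of the images of the letters of a list in the amalgam of images. -/
def foldList (N : Subgroup (PushoutI φ)) [N.Normal] (l : List (Σ i, A i)) :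
    List (Σ i, factorImage φ N i) :=
  l.map fun s => ⟨s.1, ⟨(of (φ := φ) s.1 s.2 : PushoutI φ), s.2, rfl⟩⟩

theorem amalgFold_amalgProd (N : Subgroup (PushoutI φ)) [N.Normal] (l : List (Σ i, A i)) :
    amalgFold N (amalgProd φ l) = amalgProd _ (foldList N l) := by
  induction l with
  | nil => simp [foldList]
  | cons s l ih =>
    rw [amalgProd_cons, map_mul, ih, amalgFold_of]
    simp [foldList]

theorem IsAmalgReduced.foldList {N : Subgroup (PushoutI φ)} [N.Normal] {l : List (Σ i, A i)}
    (hl : IsAmalgReduced φ l) (hN : ∀ s ∈ l, ∀ c, of s.1 s.2 * base φ c ∉ N) :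
    IsAmalgReduced (fun i => Subgroup.inclusion (baseImage_le (φ := φ) N i)) (foldList N l) := by
  refine ⟨?_, fun s hs => ?_⟩
  · rw [_root_.foldList, List.isChain_map]
    exact hl.1
  · obtain ⟨t, ht, rfl⟩ := List.mem_map.1 hs
    rintro ⟨⟨_, c, rfl⟩, hc⟩
    have hc' : (base φ c : PushoutI φ ⧸ N) = (of (φ := φ) t.1 t.2 : PushoutI φ) :=
      congrArg Subtype.val hc
    refine hN t ht c⁻¹ ?_
    rw [← QuotientGroup.eq_one_iff, QuotientGroup.mk_mul, ← hc', map_inv, QuotientGroup.mk_inv,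
      mul_inv_cancel]

theorem IsAmalgCyclicallyReduced.foldList {N : Subgroup (PushoutI φ)} [N.Normal]
    {l : List (Σ i, A i)} (hl : IsAmalgCyclicallyReduced φ l)
    (hN : ∀ s ∈ l, ∀ c, of s.1 s.2 * base φ c ∉ N) :
    IsAmalgCyclicallyReduced (fun i => Subgroup.inclusion (baseImage_le (φ := φ) N i))
      (foldList N l) := by
  refine ⟨hl.1.foldList hN, by simpa [_root_.foldList] using hl.2.1, fun s hs t ht => ?_⟩
  rw [_root_.foldList, List.getLast?_map] at hs
  rw [_root_.foldList, List.head?_map] at ht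
  simp only [Option.mem_def, Option.map_eq_some_iff] at hs ht
  obtain ⟨s, hs, rfl⟩ := hs
  obtain ⟨t, ht, rfl⟩ := ht
  exact hl.2.2 s hs t ht

end Fold

section Separation

variable {ι : Type*} {A : ι → Type*} {C : Type*} [∀ i, Group (A i)] [Group C]
  {φ : ∀ i, C →* A i} {p : ℕ}

/-- An amalgamated product whose finite `p`-quotients determine it: the factors are residually
`p`-finite, the amalgamated subgroup is closed in each of them in the pro-`p` topology, and the
pro-`p` topology of the product induces that of each factor. -/
structure IsPAmalgam (p : ℕ) (φ : ∀ i, C →* A i) : Prop where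
  injective : ∀ i, Function.Injective (φ i)
  isPResidual : ∀ i, IsPResidual p (A i)
  separates : ∀ i, ∀ a ∉ (φ i).range, ∃ M : Subgroup (A i), M.IsPOpen p ∧ ∀ c, a * φ i c ∉ M
  exists_comap_le : ∀ i (M : Subgroup (A i)), M.IsPOpen p →
    ∃ N : Subgroup (PushoutI φ), N.IsPOpen p ∧ N.comap (of i) ≤ M

/-- A reduced list stays reduced in the amalgam of images modulo a sufficiently small `N`. -/
theorem IsPAmalgam.exists_letters (hp : p.Prime) (h : IsPAmalgam p φ) (l : List (Σ i, A i))
    (hl : ∀ s ∈ l, s.2 ∉ (φ s.1).range) :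
    ∃ N₀ : Subgroup (PushoutI φ), N₀.IsPOpen p ∧ ∀ N ≤ N₀, ∀ s ∈ l, ∀ c,
      of s.1 s.2 * base φ c ∉ N := by
  induction l with
  | nil => exact ⟨⊤, .top, by simp⟩
  | cons s l ih =>
    obtain ⟨N, hN, hNl⟩ := ih fun t ht => hl t (List.mem_cons_of_mem _ ht)
    obtain ⟨M, hM, hMs⟩ := h.separates s.1 s.2 (hl s List.mem_cons_self)
    obtain ⟨N', hN', hle⟩ := h.exists_comap_le s.1 M hM
    refine ⟨N ⊓ N', hN.inf hp hN', fun K hK t ht c hc => ?_⟩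
    rcases List.mem_cons.1 ht with rfl | ht
    · refine hMs c (hle ?_)
      rw [Subgroup.mem_comap, map_mul, of_apply_eq_base]
      exact (hK hc).2
    · exact hNl K (hK.trans inf_le_left) t ht c hc

theorem IsPAmalgam.exists_amalgFold_ne_one (hp : p.Prime) [Nonempty ι] (h : IsPAmalgam p φ)
    {g : PushoutI φ} (hg : g ≠ 1) : ∃ N₀ : Subgroup (PushoutI φ), N₀.IsPOpen p ∧
      ∀ N ≤ N₀, ∀ [N.Normal], amalgFold N g ≠ 1 := by
  rcases exists_isAmalgReduced g with ⟨c, rfl⟩ | ⟨l, hl, hne, rfl⟩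
  · obtain ⟨i⟩ := ‹Nonempty ι›
    have hc : φ i c ≠ 1 := by
      rw [Ne, map_eq_one_iff _ (h.injective i)]
      rintro rfl
      exact hg (map_one _)
    obtain ⟨M, hM, hcM⟩ := h.isPResidual i _ hc
    obtain ⟨N₀, hN₀, hle⟩ := h.exists_comap_le i M hM
    refine ⟨N₀, hN₀, fun N hN _ h1 => hcM (hle (hN ?_))⟩
    rw [← of_apply_eq_base φ i, amalgFold_of, map_eq_one_iff _ (of_injective
      (fun i => Subgroup.inclusion_injective _) i)] at h1
    exact (QuotientGroup.eq_one_iff _).1 (congrArg Subtype.val h1)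
  · obtain ⟨N₀, hN₀, hlet⟩ := h.exists_letters hp l hl.2
    refine ⟨N₀, hN₀, fun N hN _ => ?_⟩
    rw [amalgFold_amalgProd]
    exact (hl.foldList (hlet N hN)).amalgProd_ne_one
      (fun i => Subgroup.inclusion_injective _) (by simpa [foldList] using hne)

theorem IsPAmalgam.exists_not_isOfFinOrder (hp : p.Prime) (h : IsPAmalgam p φ)
    {l : List (Σ i, A i)} (hl : IsAmalgCyclicallyReduced φ l) :
    ∃ N₀ : Subgroup (PushoutI φ), N₀.IsPOpen p ∧
      ∀ N ≤ N₀, ∀ [N.Normal], ¬ IsOfFinOrder (amalgFold N (amalgProd φ l)) := by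
  obtain ⟨N₀, hN₀, hlet⟩ := h.exists_letters hp l hl.1.2
  refine ⟨N₀, hN₀, fun N hN _ => ?_⟩
  rw [amalgFold_amalgProd]
  exact (hl.foldList (hlet N hN)).not_isOfFinOrder (fun i => Subgroup.inclusion_injective _)

theorem isPResidual_amalgamImage (hp : p.Prime) {N : Subgroup (PushoutI φ)} [N.Normal]
    (hN : N.IsPOpen p) : IsPResidual p (AmalgamImage φ N) := by
  have := hN.finite_quotient hp
  exact isPResidual_amalgam hp hN.isPGroup_quotient _

theorem IsPAmalgam.isPResidual_pushoutI (hp : p.Prime) [Nonempty ι] (h : IsPAmalgam p φ) :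
    IsPResidual p (PushoutI φ) := by
  intro g hg
  obtain ⟨N, hN, h1⟩ := h.exists_amalgFold_ne_one hp hg
  have := hN.normal
  obtain ⟨K, hK, hgK⟩ := isPResidual_amalgamImage hp hN _ (h1 N le_rfl)
  exact ⟨K.comap (amalgFold N), hK.comap hp _, hgK⟩

/-- Separation from a cyclic subgroup generated by a hyperbolic element. -/
theorem IsPAmalgam.pSeparates_of_isAmalgCyclicallyReduced (hp : p.Prime) [Nonempty ι]
    (h : IsPAmalgam p φ) {l : List (Σ i, A i)} (hl : IsAmalgCyclicallyReduced φ l)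
    {f g : PushoutI φ} (hf : f = amalgProd φ l) (hc : Commute f g)
    (hg : ∀ q : ℕ, q.Coprime p → g ^ q ∉ Subgroup.zpowers f) : PSeparates p f g := by
  obtain ⟨N₀, hN₀, hinf⟩ := h.exists_not_isOfFinOrder hp hl
  rw [← hf] at hinf
  have := hN₀.normal
  have hinj : ∀ {N : Subgroup (PushoutI φ)} (_ : N ≤ N₀) [N.Normal] {x y : ℤ},
      amalgFold N f ^ x = amalgFold N f ^ y → x = y := by
    intro N hN _ x y hxy
    exact injective_zpow_iff_not_isOfFinOrder.2 (hinf _ hN) hxy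
  have hrel : ∀ {N : Subgroup (PushoutI φ)} (_ : N ≤ N₀) [N.Normal] (_ : N.IsPOpen p),
      ∃ x y : ℤ, y ≠ 0 ∧ amalgFold N f ^ x = amalgFold N g ^ y := by
    intro N hN _ hNp
    have := hNp.finite_quotient hp
    obtain ⟨x, y, hxy, he⟩ := exists_zpow_eq_zpow_of_commute_amalgam _ (hc.map (amalgFold N))
    refine ⟨x, y, ?_, he⟩
    rintro rfl
    refine hxy.elim (fun hx => hx (hinj hN (y := 0) ?_)) (fun h => h rfl)
    rw [he, zpow_zero, zpow_zero]
  obtain ⟨x, y, hy, hxy⟩ := hrel le_rfl hN₀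
  by_cases hv : f ^ x = g ^ y
  · exact .of_pow_mem hp (h.isPResidual_pushoutI hp) hc hy ⟨x, hv⟩ hg
  obtain ⟨N₁, hN₁, hne⟩ := h.exists_amalgFold_ne_one hp (g := f ^ x * (g ^ y)⁻¹)
    (by rwa [Ne, mul_inv_eq_one])
  have hN := hN₀.inf hp hN₁
  have := hN.normal
  have hres := isPResidual_amalgamImage hp hN
  obtain ⟨x', y', hy', hxy'⟩ := hrel inf_le_left hN
  refine .comap hp (amalgFold (N₀ ⊓ N₁)) (.of_pow_mem hp hres (hc.map _) hy' ⟨x', hxy'⟩ ?_)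
  rintro q hq ⟨r, hr⟩
  -- Modulo `N₀` the relation `g ^ q = f ^ r` forces `x * q = r * y`.
  have hr₀ : amalgFold N₀ f ^ r = amalgFold N₀ g ^ q := by
    have hmem : f ^ r * (g ^ q)⁻¹ ∈ (amalgFold (N₀ ⊓ N₁)).ker := by
      rw [MonoidHom.mem_ker, map_mul, map_inv, map_zpow, map_pow, mul_inv_eq_one]
      exact hr
    have := ker_amalgFold_le inf_le_left hmem
    rwa [MonoidHom.mem_ker, map_mul, map_inv, map_zpow, map_pow, mul_inv_eq_one] at this
  have hprop : x * q = r * y := by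
    refine hinj le_rfl ?_
    rw [zpow_mul, hxy, ← zpow_mul, mul_comm, zpow_mul, zpow_natCast, ← hr₀, ← zpow_mul]
  refine hne _ inf_le_right (hres.eq_one_of_zpow_eq_one (q := q)
    (Nat.isCoprime_iff_coprime.2 hq) ?_)
  have hr' : amalgFold (N₀ ⊓ N₁) f ^ r = amalgFold (N₀ ⊓ N₁) g ^ q := hr
  have hc' : Commute (amalgFold (N₀ ⊓ N₁) f ^ x) ((amalgFold (N₀ ⊓ N₁) g ^ y)⁻¹) :=
    ((hc.map _).zpow_zpow _ _).inv_right
  rw [map_mul, map_inv, map_zpow, map_zpow, hc'.mul_zpow, inv_zpow, mul_inv_eq_one, ← zpow_mul,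
    hprop, ← zpow_mul, mul_comm y, zpow_mul _ (q : ℤ), zpow_natCast, ← hr', zpow_mul]

/-- Separation of elements of the amalgamated product from cyclic subgroups, assuming it in the
factors. -/
theorem IsPAmalgam.pSeparates (hp : p.Prime) [Nonempty ι] (h : IsPAmalgam p φ)
    (hcyc : ∀ i (a b : A i), (∀ q : ℕ, q.Coprime p → b ^ q ∉ Subgroup.zpowers a) →
      PSeparates p a b)
    {f g : PushoutI φ} (hg : ∀ q : ℕ, q.Coprime p → g ^ q ∉ Subgroup.zpowers f) :
    PSeparates p f g := by
  by_cases hc : Commute f g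
  swap
  · exact .of_not_commute (h.isPResidual_pushoutI hp) hc
  have hconj : ∀ (d f g : PushoutI φ),
      (∀ q : ℕ, q.Coprime p → g ^ q ∉ Subgroup.zpowers f) →
      ∀ q : ℕ, q.Coprime p → (d * g * d⁻¹) ^ q ∉ Subgroup.zpowers (d * f * d⁻¹) := by
    rintro d f g h q hq ⟨r, hr⟩
    refine h q hq ⟨r, ?_⟩
    simp only [conj_zpow, conj_pow] at hr
    exact mul_left_cancel (mul_right_cancel hr)
  obtain ⟨d, ⟨i, a, hfa⟩ | ⟨l, hl, hfl⟩⟩ := PushoutI.exists_conj f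
  swap
  · exact .of_conj hp d (h.pSeparates_of_isAmalgCyclicallyReduced hp hl hfl
      ((Commute.conj_iff d).2 hc) (hconj d f g hg))
  refine .of_conj hp d ?_
  replace hg := hconj d f g hg
  replace hc := (Commute.conj_iff d).2 hc
  generalize d * g * d⁻¹ = g at hg hc
  rw [hfa] at hg hc ⊢
  obtain ⟨c, ⟨j, b, hgb⟩ | ⟨l, hl, hgl⟩⟩ := PushoutI.exists_conj g
  · -- Commuting elliptic elements are conjugate into a common factor.
    obtain rfl : g = c⁻¹ * of j b * c⁻¹⁻¹ := by
      rw [← hgb]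
      group
    obtain ⟨d, k, a', b', h1, h2⟩ := exists_conj_mem_common_factor h.injective hc
    refine .of_conj hp d ?_
    replace hg := hconj d _ _ hg
    rw [h1, h2] at hg ⊢
    obtain ⟨M, hM, hsep⟩ := hcyc k a' b' (by
      rintro q hq ⟨r, hr⟩
      exact hg q hq ⟨r, by simpa using congrArg (of (φ := φ) k) hr⟩)
    obtain ⟨N, hN, hle⟩ := h.exists_comap_le k M hM
    exact ⟨N, hN, fun i hi => hsep i (hle (by simpa using hi))⟩
  · -- An elliptic element has finite order in an amalgam of finite groups.
    obtain ⟨N, hN, hinf⟩ := h.exists_not_isOfFinOrder hp hl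
    have := hN.normal
    have := hN.finite_quotient hp
    have hfin : IsOfFinOrder (amalgFold N (of i a)) := by
      rw [amalgFold_of]
      exact MonoidHom.isOfFinOrder _ (isOfFinOrder_of_finite _)
    refine .comap hp (amalgFold N) (.of_isOfFinOrder hp (isPResidual_amalgamImage hp hN) hfin ?_)
    rintro ⟨r, hr⟩
    refine hinf N le_rfl ?_
    rw [← hgl, map_mul, map_mul, map_inv, ← hr]
    exact (MulAut.conj (amalgFold N c)).toMonoidHom.isOfFinOrder hfin.zpow

end Separation

/-! ### The amalgamated product of two nilpotent groups -/

section TwoFactors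

variable {A : Type u} {B : Type v} [Group A] [Group B] {H : Subgroup A} {K : Subgroup B} {p : ℕ}

/-- The two factors as a family indexed by `Bool`, lifted to a common universe. -/
def TwoFactors (A : Type u) (B : Type v) : Bool → Type (max u v)
  | true => ULift.{v} A
  | false => ULift.{u} B

instance : ∀ b, Group (TwoFactors A B b)
  | true => inferInstanceAs (Group (ULift.{v} A))
  | false => inferInstanceAs (Group (ULift.{u} B))

/-- The first factor is isomorphic to `A`. -/
def twoFactorsTrue (A : Type u) (B : Type v) [Group A] [Group B] : TwoFactors A B true ≃* A :=
  MulEquiv.ulift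

/-- The second factor is isomorphic to `B`. -/
def twoFactorsFalse (A : Type u) (B : Type v) [Group A] [Group B] : TwoFactors A B false ≃* B :=
  MulEquiv.ulift

/-- The embeddings of the amalgamated subgroup `H` in the two factors. -/
def twoFactorsMap (φ : H ≃* K) : ∀ b, H →* TwoFactors A B b
  | true => (twoFactorsTrue A B).symm.toMonoidHom.comp H.subtype
  | false => (twoFactorsFalse A B).symm.toMonoidHom.comp (K.subtype.comp φ.toMonoidHom)

theorem twoFactorsMap_true (φ : H ≃* K) (c : H) :
    twoFactorsMap φ true c = (twoFactorsTrue A B).symm c := rfl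

theorem twoFactorsMap_false (φ : H ≃* K) (c : H) :
    twoFactorsMap φ false c = (twoFactorsFalse A B).symm (φ c) := rfl

/-- The comparison map between the two constructions of the amalgamated product. -/
def AmalgamatedProduct.toPushoutI (φ : H ≃* K) :
    AmalgamatedProduct φ →* PushoutI (twoFactorsMap φ) :=
  QuotientGroup.lift _
    (Coprod.lift ((of true).comp (twoFactorsTrue A B).symm.toMonoidHom)
      ((of false).comp (twoFactorsFalse A B).symm.toMonoidHom)) <| by
    refine Subgroup.normalClosure_le_normal ?_
    rintro _ ⟨c, rfl⟩
    have h1 : of true ((twoFactorsTrue A B).symm c) = base (twoFactorsMap φ) c :=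
      of_apply_eq_base (twoFactorsMap φ) true c
    have h2 : of false ((twoFactorsFalse A B).symm (φ c)) = base (twoFactorsMap φ) c :=
      of_apply_eq_base (twoFactorsMap φ) false c
    simp [MonoidHom.mem_ker, h1, h2]

theorem AmalgamatedProduct.toPushoutI_injective (φ : H ≃* K) :
    Function.Injective (AmalgamatedProduct.toPushoutI φ) := by
  let i : ∀ b, TwoFactors A B b →* AmalgamatedProduct φ
    | true => (QuotientGroup.mk' _).comp (Coprod.inl.comp (twoFactorsTrue A B).toMonoidHom)
    | false => (QuotientGroup.mk' _).comp (Coprod.inr.comp (twoFactorsFalse A B).toMonoidHom)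
  let η : PushoutI (twoFactorsMap φ) →* AmalgamatedProduct φ :=
    PushoutI.lift i ((QuotientGroup.mk' _).comp (Coprod.inl.comp H.subtype)) fun b => by
      ext c
      cases b
      · refine (mul_inv_eq_one.1 ?_).symm
        exact (QuotientGroup.eq_one_iff _).2 (Subgroup.subset_normalClosure ⟨c, rfl⟩)
      · rfl
  have hη : η.comp (AmalgamatedProduct.toPushoutI φ) = .id _ := by
    refine QuotientGroup.monoidHom_ext _ (Coprod.hom_ext ?_ ?_)
    · ext a
      simp [η, AmalgamatedProduct.toPushoutI, i]
    · ext b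
      simp [η, AmalgamatedProduct.toPushoutI, i]
  exact Function.LeftInverse.injective (g := η) (DFunLike.congr_fun hη)

/-- By Higman's theorem, the amalgamated product has enough finite `p`-quotients when both factors
have finite `p`-quotients in which the generator of the amalgamated subgroup has order any given
sufficiently large power of `p`. -/
theorem exists_isPOpen_comap_le (hp : p.Prime) [Group.FG A] [Group.FG B] [Group.IsNilpotent A]
    [Group.IsNilpotent B] (hA : IsPPrimeIsolated p (⊥ : Subgroup A))
    (hB : IsPPrimeIsolated p (⊥ : Subgroup B)) (φ : H ≃* K) {c : H}
    (hH : ∀ x : H, x ∈ Subgroup.zpowers c) (hc : ¬ IsOfFinOrder c)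
    {M : Subgroup A} (hM : M.IsPOpen p) {L : Subgroup B} (hL : L.IsPOpen p) :
    ∃ N : Subgroup (PushoutI (twoFactorsMap φ)), N.IsPOpen p ∧
      N.comap (of true) ≤ M.comap (twoFactorsTrue A B).toMonoidHom ∧
      N.comap (of false) ≤ L.comap (twoFactorsFalse A B).toMonoidHom := by
  have hcA : ¬ IsOfFinOrder (c : A) := by
    rwa [Submonoid.isOfFinOrder_coe]
  have hcB : ¬ IsOfFinOrder (φ c : B) := by
    rw [Submonoid.isOfFinOrder_coe]
    exact fun h => hc (by simpa using φ.symm.toMonoidHom.isOfFinOrder h)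
  obtain ⟨e, he⟩ := Group.exists_isPOpen_zpow_mem_iff hp hA hcA hM
  obtain ⟨e', he'⟩ := Group.exists_isPOpen_zpow_mem_iff hp hB hcB hL
  obtain ⟨M', hM', hMM, hM'c⟩ := he (max e e') (le_max_left _ _)
  obtain ⟨L', hL', hLL, hL'c⟩ := he' (max e e') (le_max_right _ _)
  have := hM'.normal
  have := hL'.normal
  have := hM'.finite_quotient hp
  have := hL'.finite_quotient hp
  have hord : orderOf (QuotientGroup.mk' M' c) = orderOf (QuotientGroup.mk' L' (φ c)) := by
    refine orderOf_eq_orderOf_iff.2 fun n => ?_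
    have h1 := hM'c n
    have h2 := hL'c n
    rw [zpow_natCast] at h1 h2
    rw [← map_pow, ← map_pow, QuotientGroup.mk'_apply, QuotientGroup.mk'_apply,
      QuotientGroup.eq_one_iff, QuotientGroup.eq_one_iff, h1, h2]
  obtain ⟨P, _, α, β, _, hP, hα, hβ, hαβ⟩ := embedsInFinitePGroup_of_orderOf_eq hp (A ⧸ M') (B ⧸ L')
    _ _ hM'.isPGroup_quotient hL'.isPGroup_quotient hord
  let i : ∀ b, TwoFactors A B b →* P
    | true => (α.comp (QuotientGroup.mk' M')).comp (twoFactorsTrue A B).toMonoidHom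
    | false => (β.comp (QuotientGroup.mk' L')).comp (twoFactorsFalse A B).toMonoidHom
  have hi : ∀ b, (i b).comp (twoFactorsMap φ b) = (α.comp (QuotientGroup.mk' M')).comp H.subtype := by
    rintro (_ | _)
    · ext x
      obtain ⟨j, rfl⟩ := hH x
      have : i false (twoFactorsMap φ false c) = α (QuotientGroup.mk' M' c) := hαβ.symm
      simp only [MonoidHom.comp_apply, map_zpow, this]
      rfl
    · rfl
  let δ : PushoutI (twoFactorsMap φ) →* P := PushoutI.lift i _ hi
  refine ⟨δ.ker, .ker hp hP δ, fun x hx => hMM ?_, fun x hx => hLL ?_⟩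
  · rw [Subgroup.mem_comap, MonoidHom.mem_ker, lift_of] at hx
    exact (QuotientGroup.eq_one_iff _).1 ((map_eq_one_iff α hα).1 hx)
  · rw [Subgroup.mem_comap, MonoidHom.mem_ker, lift_of] at hx
    exact (QuotientGroup.eq_one_iff _).1 ((map_eq_one_iff β hβ).1 hx)

theorem IsPPrimeIsolated.exists_forall_mul_notMem (hp : p.Prime) [Group.FG A] [Group.IsNilpotent A]
    (hA : IsPPrimeIsolated p (⊥ : Subgroup A)) {c : A} (hc : IsPPrimeIsolated p (Subgroup.zpowers c))
    {a : A} (ha : a ∉ Subgroup.zpowers c) :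
    ∃ M : Subgroup A, M.IsPOpen p ∧ ∀ x ∈ Subgroup.zpowers c, a * x ∉ M := by
  obtain ⟨M, hM, h⟩ := Group.pSeparates_of_isNilpotent hp hA (f := c) (g := a)
    fun q hq h => ha (hc.mem_of_pow_mem hq hp.ne_one h)
  exact ⟨M, hM, by rintro _ ⟨j, rfl⟩; exact h j⟩

theorem isPAmalgam_twoFactorsMap (hp : p.Prime) [Group.FG A] [Group.FG B] [Group.IsNilpotent A]
    [Group.IsNilpotent B] (hA : IsPPrimeIsolated p (⊥ : Subgroup A))
    (hB : IsPPrimeIsolated p (⊥ : Subgroup B)) (hH : IsPPrimeIsolated p H)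
    (hK : IsPPrimeIsolated p K) (φ : H ≃* K) {c : H}
    (hgen : ∀ x : H, x ∈ Subgroup.zpowers c) (hc : ¬ IsOfFinOrder c) :
    IsPAmalgam p (twoFactorsMap φ) where
  injective := by
    rintro (_ | _)
    · exact (twoFactorsFalse A B).symm.injective.comp (Subtype.val_injective.comp φ.injective)
    · exact (twoFactorsTrue A B).symm.injective.comp Subtype.val_injective
  isPResidual := by
    rintro (_ | _)
    · exact (Group.isPResidual_of_isolated_bot hp hB).of_injective hp
        (f := (twoFactorsFalse A B).toMonoidHom) (twoFactorsFalse A B).injective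
    · exact (Group.isPResidual_of_isolated_bot hp hA).of_injective hp
        (f := (twoFactorsTrue A B).toMonoidHom) (twoFactorsTrue A B).injective
  separates := by
    rintro (_ | _) a ha
    · have hKc : K = Subgroup.zpowers (φ c : B) := by
        refine le_antisymm (fun x hx => ?_) (by simp)
        obtain ⟨j, hj⟩ := hgen (φ.symm ⟨x, hx⟩)
        have := congrArg (fun y => (φ y : B)) hj
        exact ⟨j, by simpa using this⟩
      rw [hKc] at hK
      obtain ⟨M, hM, h⟩ := hB.exists_forall_mul_notMem hp hK
        (a := twoFactorsFalse A B a) (by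
          rw [← hKc]
          intro h
          exact ha ⟨φ.symm ⟨_, h⟩, by simp [twoFactorsMap_false]⟩)
      exact ⟨M.comap (twoFactorsFalse A B).toMonoidHom, hM.comap hp _, fun x hx =>
        h (φ x) (hKc ▸ (φ x).2) (by simpa [twoFactorsMap_false] using hx)⟩
    · have hHc : H = Subgroup.zpowers (c : A) := by
        refine le_antisymm (fun x hx => ?_) (by simp)
        obtain ⟨j, hj⟩ := hgen ⟨x, hx⟩
        exact ⟨j, by simpa using congrArg Subtype.val hj⟩
      rw [hHc] at hH
      obtain ⟨M, hM, h⟩ := hA.exists_forall_mul_notMem hp hH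
        (a := twoFactorsTrue A B a) (by
          rw [← hHc]
          intro h
          exact ha ⟨⟨_, h⟩, by simp [twoFactorsMap_true]⟩)
      exact ⟨M.comap (twoFactorsTrue A B).toMonoidHom, hM.comap hp _, fun x hx =>
        h x (hHc ▸ x.2) (by simpa [twoFactorsMap_true] using hx)⟩
  exists_comap_le := by
    rintro (_ | _) M hM
    · obtain ⟨N, hN, -, h⟩ := exists_isPOpen_comap_le hp hA hB φ hgen hc .top
        (hM.comap hp (twoFactorsFalse A B).symm.toMonoidHom)
      exact ⟨N, hN, fun x hx => by simpa using h hx⟩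
    · obtain ⟨N, hN, h, -⟩ := exists_isPOpen_comap_le hp hA hB φ hgen hc
        (hM.comap hp (twoFactorsTrue A B).symm.toMonoidHom) .top
      exact ⟨N, hN, fun x hx => by simpa using h hx⟩

theorem AmalgamatedProduct.pSeparates (hp : p.Prime) [Group.FG A] [Group.FG B]
    [Group.IsNilpotent A] [Group.IsNilpotent B] (hA : IsPPrimeIsolated p (⊥ : Subgroup A))
    (hB : IsPPrimeIsolated p (⊥ : Subgroup B)) (hH : IsPPrimeIsolated p H)
    (hK : IsPPrimeIsolated p K) (φ : H ≃* K) {c : H}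
    (hgen : ∀ x : H, x ∈ Subgroup.zpowers c) (hc : ¬ IsOfFinOrder c) {f g : AmalgamatedProduct φ}
    (hg : ∀ q : ℕ, q.Coprime p → g ^ q ∉ Subgroup.zpowers f) : PSeparates p f g := by
  refine .comap hp (AmalgamatedProduct.toPushoutI φ)
    ((isPAmalgam_twoFactorsMap hp hA hB hH hK φ hgen hc).pSeparates hp ?_ ?_)
  · rintro (_ | _) a b hab
    · refine .comap hp (twoFactorsFalse A B).toMonoidHom (Group.pSeparates_of_isNilpotent hp hB ?_)
      rintro q hq ⟨r, hr⟩
      refine hab q hq ⟨r, (twoFactorsFalse A B).injective ?_⟩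
      simpa using hr
    · refine .comap hp (twoFactorsTrue A B).toMonoidHom (Group.pSeparates_of_isNilpotent hp hA ?_)
      rintro q hq ⟨r, hr⟩
      refine hab q hq ⟨r, (twoFactorsTrue A B).injective ?_⟩
      simpa using hr
  · rintro q hq ⟨r, hr⟩
    refine hg q hq ⟨r, AmalgamatedProduct.toPushoutI_injective φ ?_⟩
    rw [map_pow, ← hr]
    exact map_zpow _ _ _

end TwoFactors

section Separability

variable {p : ℕ} {X : Type u} [Group X]

theorem IsResiduallyPFinite.isPResidual (hp : p.Prime) (hX : IsResiduallyPFinite p X) :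
    IsPResidual p X := by
  intro x hx
  obtain ⟨P, _, ψ, _, hP, -, hψ⟩ := hX x (by simpa using hx)
  exact ⟨ψ.ker, .ker hp hP ψ, fun h => hψ ⟨1, by simp, by rw [map_one]; exact h.symm⟩⟩

theorem IsPPrimeIsolated.isPSeparable_zpowers (hp : p.Prime) {f : X}
    (hf : IsPPrimeIsolated p (Subgroup.zpowers f))
    (h : ∀ g : X, (∀ q : ℕ, q.Coprime p → g ^ q ∉ Subgroup.zpowers f) → PSeparates p f g) :
    IsPSeparable p (Subgroup.zpowers f) := by
  intro g hg
  obtain ⟨N, hN, hNg⟩ := h g fun q hq h => hg (hf.mem_of_pow_mem hq hp.ne_one h)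
  have := hN.normal
  refine ⟨X ⧸ N, inferInstance, QuotientGroup.mk' N, hN.finite_quotient hp, hN.isPGroup_quotient,
    QuotientGroup.mk'_surjective N, ?_⟩
  rintro ⟨_, ⟨j, rfl⟩, hj⟩
  refine hNg (-j) ((QuotientGroup.eq_one_iff _).1 ?_)
  rw [QuotientGroup.mk_mul, ← QuotientGroup.mk'_apply, ← QuotientGroup.mk'_apply, ← hj, ← map_mul]
  simp

end Separability

theorem corollary2p4 (p : ℕ) (hp : p.Prime)
    {A : Type u} {B : Type v} [Group A] [Group B]
    (hAfg : Group.FG A) (hBfg : Group.FG B)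
    (hAnil : Group.IsNilpotent A) (hBnil : Group.IsNilpotent B)
    (hAres : IsResiduallyPFinite p A) (hBres : IsResiduallyPFinite p B)
    (h : A) (k : B)
    (hh : IsMaximalInfiniteCyclic (Subgroup.zpowers h))
    (hk : IsMaximalInfiniteCyclic (Subgroup.zpowers k))
    (m n : ℕ) (hm : ∃ s : ℕ, m = p ^ s) (hn : ∃ t : ℕ, n = p ^ t)
    (φ : Subgroup.zpowers (h ^ m) ≃* Subgroup.zpowers (k ^ n))
    (F : Subgroup (AmalgamatedProduct φ)) (hFcyc : IsCyclic F)
    (hFiso : IsPPrimeIsolated p F) :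
    IsPSeparable p F := by
  obtain ⟨s, rfl⟩ := hm
  obtain ⟨t, rfl⟩ := hn
  have hA := hAres.isPResidual hp
  have hB := hBres.isPResidual hp
  obtain ⟨f, rfl⟩ := (Subgroup.isCyclic_iff_exists_zpowers_eq_top F).1 hFcyc
  refine hFiso.isPSeparable_zpowers hp fun g hg => ?_
  refine AmalgamatedProduct.pSeparates hp (hA.isolated_bot hp) (hB.isolated_bot hp)
    (hh.isPPrimeIsolated_zpowers_pow hp hA s) (hk.isPPrimeIsolated_zpowers_pow hp hB t) φ
    (c := ⟨h ^ p ^ s, Subgroup.mem_zpowers _⟩) ?_ ?_ hg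
  · rintro ⟨_, j, rfl⟩
    exact ⟨j, Subtype.ext (by simp)⟩
  · rw [← Submonoid.isOfFinOrder_coe, isOfFinOrder_pow]
    simpa [hp.ne_zero] using hh.not_isOfFinOrder
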